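/- Let $d\ge 2$, let $\Omega\subset\mathbb R^d$ be a bounded Lipschitz domain with boundary $\Gamma=\partial\Omega$, and let $|\cdot|$ also denote $(d-1)$-dimensional surface measure on $\Gamma$. A mesh $\mathcal T$ of $\Gamma$ is a finite set of subsets of $\Gamma$ such that each $T\in\mathcal T$ is the image under a bi-Lipschitz map of a compact Lipschitz domain in $\mathbb R^{d-1}$ (the closure of a bounded Lipschitz domain), $\Gamma=\bigcup_{T\in\mathcal T}T$, and $|T\cap T'|=0$ for $T\ne T'$. Let $h_T:=|T|^{1/(d-1)}$ and let $h$ be the function on $\Gamma$ (defined almost everywhere) with $h|_T=h_T$. For $\omega\subseteq\Gamma$ let $\pi^0(\omega):=\omega$, $\pi^q(\omega):=\bigcup\{T\in\mathcal T: T\cap\pi^{q-1}(\omega)\neq\emptyset\}$ for $q\ge1$, $\pi:=\pi^1$, $\pi(z):=\pi(\{z\})$, and $\Pi(\omega):=\{T\in\mathcal T:T\subseteq\pi(\omega)\}$. For scalar $v$ and measurable $\omega\subseteq\Gamma$ let $$|v|_{H^{1/2}(\omega)}^2:=\int_\omega\int_\omega\frac{|v(x)-v(y)|^2}{|x-y|^{d}}\,dx\,dy,\qquad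 \|v\|_{H^{1/2}(\Gamma)}^2:=\|v\|_{L^2(\Gamma)}^2+|v|_{H^{1/2}(\Gamma)}^2,$$ and let $\nabla_\Gamma$ be the weak surface gradient; for $v=(v_1,\dots,v_D)$ the squared norms are summed over the components. All functions are complex-valued. Given constants $C_{\rm patch},C_{\rm locuni},C_{\rm shape},C_{\rm cent},C_{\rm semi}>0$, $q_{\rm supp}\in\mathbb N_0$ and $0<\rho_{\rm unity}<1$, there is a constant $C>0$, depending only on $d$, $\Gamma$ and these constants, with the following property. Let $D\ge1$, let $\mathcal T$ be a mesh of $\Gamma$ such that - (M1) $\#\Pi(T)\le C_{\rm patch}$ for all $T\in\mathcal T$; - (M2) $\operatorname{diam}(T)/\operatorname{diam}(T')\le C_{\rm locuni}$ for all $T\in\mathcal T$, $T'\in\Pi(T)$; - (M3) $C_{\rm shape}^{-1}\le\operatorname{diam}(T)/h_T\le C_{\rm shape}$ for all $T\in\mathcal T$; - (M4) $\operatorname{diam}(T)\le C_{\rm cent}\operatorname{dist}(T,\Gamma\setminus\pi(T))$ for all $T\in\mathcal T$, where $\operatorname{dist}(T,\emptyset):=\operatorname{diam}(\Gamma)$;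 - (M5) $|v|_{H^{1/2}(\pi(z))}\le C_{\rm semi}\operatorname{diam}(\pi(z))^{1/2}\|\nabla_\Gamma v\|_{L^2(\pi(z))}$ for all scalar $v\in H^1(\Gamma)$ and all $z\in\Gamma$; and let $\mathcal X\subset L^2(\Gamma)^D$ be a finite-dimensional space and $\Psi_{T,j}\in\mathcal X$ ($T\in\mathcal T$, $1\le j\le D$) functions such that - (S4) $T\subseteq\operatorname{supp}(\Psi_{T,j})\subseteq\pi^{q_{\rm supp}}(T)$, $(\Psi_{T,j})_{j'}=0$ for $j'\ne j$, and $\|1-(\Psi_{T,j})_j\|_{L^2(\operatorname{supp}(\Psi_{T,j}))}\le\rho_{\rm unity}\,|\operatorname{supp}((\Psi_{T,j})_j)|^{1/2}$. Then every $v\in H^1(\Gamma)^D$ with $(v,\Psi_{T,j})_{L^2(\Gamma)}=0$ for all $T\in\mathcal T$ and $1\le j\le D$ satisfies $$\|v\|_{H^{1/2}(\Gamma)}\le C\,\|h^{1/2}\nabla_\Gamma v\|_{L^2(\Gamma)}.$$ -/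

import Mathlib

open MeasureTheory Topology
open scoped ENNReal NNReal

noncomputable section

namespace BEM

/-- Euclidean space `ℝⁿ`. -/
abbrev Eucl (n : ℕ) : Type := EuclideanSpace ℝ (Fin n)

/-- `O ⊆ ℝⁿ` is, after a rigid motion, the region strictly below the graph of a Lipschitz function
of `n - 1` variables. -/
def IsLipschitzHypograph {n : ℕ} (O : Set (Eucl n)) : Prop :=
  ∃ (e : Eucl n ≃ᵃⁱ[ℝ] WithLp 2 (Eucl (n - 1) × ℝ)) (ζ : Eucl (n - 1) → ℝ) (K : ℝ≥0),
    LipschitzWith K ζ ∧ O = {x | (e x).snd < ζ (e x).fst}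

/-- Bounded Lipschitz domains in `ℝⁿ`: nonempty bounded open sets which near each boundary point
coincide with a Lipschitz hypograph. The boundary is compact, so finitely many of the
neighbourhoods cover it. Connectedness is not required. -/
structure IsBoundedLipschitzDomain {n : ℕ} (O : Set (Eucl n)) : Prop where
  isOpen : IsOpen O
  nonempty : O.Nonempty
  isBounded : Bornology.IsBounded O
  locally_hypograph : ∀ x ∈ frontier O, ∃ W H : Set (Eucl n),
    IsOpen W ∧ x ∈ W ∧ IsLipschitzHypograph H ∧ W ∩ O = W ∩ H

/-- `γ` is bi-Lipschitz from `s` onto its image. -/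
def BiLipschitzOn {m n : ℕ} (γ : Eucl m → Eucl n) (s : Set (Eucl m)) : Prop :=
  ∃ K : ℝ≥0, LipschitzOnWith K γ s ∧
    ∀ x ∈ s, ∀ y ∈ s, dist x y ≤ K * dist (γ x) (γ y)

/-- The surface measure on `Γ ⊆ ℝᵈ`: the `(d-1)`-dimensional Hausdorff measure, normalized so that
it is Lebesgue measure on `(d-1)`-dimensional planes. -/
def surfaceMeasure {d : ℕ} (Γ : Set (Eucl d)) : Measure (Eucl d) :=
  (Measure.euclideanHausdorffMeasure (d - 1)).restrict Γ

/-- The complex space `L²(Γ)`. -/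
abbrev L2 {d : ℕ} (Γ : Set (Eucl d)) : Type := Lp ℂ 2 (surfaceMeasure Γ)

/-- The space `L²(Γ)ᵈ` of square integrable complex vector fields. -/
abbrev L2Field {d : ℕ} (Γ : Set (Eucl d)) : Type :=
  Lp (EuclideanSpace ℂ (Fin d)) 2 (surfaceMeasure Γ)

/-! ### Weak derivatives and the surface gradient -/

/-- `u ∈ H¹(U)` with weak gradient `w ∈ L²(U)ᵐ`, for an open set `U ⊆ ℝᵐ`. -/
def HasWeakGradientOn {m : ℕ} (U : Set (Eucl m)) (u : Eucl m → ℂ)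
    (w : Eucl m → EuclideanSpace ℂ (Fin m)) : Prop :=
  MemLp u 2 (volume.restrict U) ∧ MemLp w 2 (volume.restrict U) ∧
    ∀ φ : Eucl m → ℝ, ContDiff ℝ ((⊤ : ℕ∞) : WithTop ℕ∞) φ → HasCompactSupport φ →
      tsupport φ ⊆ U → ∀ k : Fin m,
        ∫ s in U, (fderiv ℝ φ s (EuclideanSpace.single k 1)) • u s = - ∫ s in U, φ s • w s k

/-- `γ : U → Γ` is a bi-Lipschitz parametrization, over an open set `U ⊆ ℝᵈ⁻¹`, of a relatively
open part of `Γ`. -/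
def IsChart {d : ℕ} (Γ : Set (Eucl d)) (U : Set (Eucl (d - 1))) (γ : Eucl (d - 1) → Eucl d) :
    Prop :=
  IsOpen U ∧ BiLipschitzOn γ U ∧ ∃ O : Set (Eucl d), IsOpen O ∧ γ '' U = O ∩ Γ

/-- The Jacobian matrix `Dγ(s)`. -/
def jacobian {d : ℕ} (γ : Eucl (d - 1) → Eucl d) (s : Eucl (d - 1)) :
    Matrix (Fin d) (Fin (d - 1)) ℝ :=
  Matrix.of fun i k => (fderiv ℝ γ s (EuclideanSpace.single k 1)) i

/-- `v ∈ H¹(Γ)` with weak surface gradient `∇_Γ v = g`: in every chart `γ` one has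
`v ∘ γ ∈ H¹(U)` and `g ∘ γ = Dγ (Dγᵀ Dγ)⁻¹ ∇(v ∘ γ)` almost everywhere. (For the boundary of a
Lipschitz domain the charts cover `Γ`, so that `g` is unique.) -/
def HasSurfaceGradient {d : ℕ} (Γ : Set (Eucl d)) (v : L2 Γ) (g : L2Field Γ) : Prop :=
  ∀ (U : Set (Eucl (d - 1))) (γ : Eucl (d - 1) → Eucl d), IsChart Γ U γ →
    ∃ w : Eucl (d - 1) → EuclideanSpace ℂ (Fin (d - 1)),
      HasWeakGradientOn U (fun s => v (γ s)) w ∧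
      ∀ᵐ s ∂(volume.restrict U), ∀ i : Fin d,
        g (γ s) i =
          (((jacobian γ s * ((jacobian γ s).transpose * jacobian γ s)⁻¹).map
            (fun r : ℝ => (r : ℂ))).mulVec (fun k => w s k)) i

/-! ### Sobolev--Slobodeckij norms -/

/-- The seminorm `|v|_{H^σ(ω)}` for `0 < σ < 1` and `ω ⊆ Γ`, with values in `[0, ∞]`. -/
def slobodeckijSeminorm {d : ℕ} (Γ : Set (Eucl d)) (σ : ℝ) (ω : Set (Eucl d)) (v : L2 Γ) : ℝ≥0∞ :=
  (∫⁻ x in ω, ∫⁻ y in ω, ‖v x - v y‖ₑ ^ 2 / edist x y ^ ((d : ℝ) - 1 + 2 * σ)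
    ∂(surfaceMeasure Γ) ∂(surfaceMeasure Γ)) ^ (1 / 2 : ℝ)

/-- The norm `‖v‖_{H^σ(Γ)}` of `v ∈ H^σ(Γ)^D` for `0 < σ < 1`, with values in `[0, ∞]`. -/
def slobodeckijNorm {d D : ℕ} (Γ : Set (Eucl d)) (σ : ℝ) (v : Fin D → L2 Γ) : ℝ≥0∞ :=
  (∑ j, (eLpNorm (v j) 2 (surfaceMeasure Γ) ^ 2 + slobodeckijSeminorm Γ σ Γ (v j) ^ 2))
    ^ (1 / 2 : ℝ)

/-! ### Meshes -/

/-- `𝒯` is a mesh of `Γ`. -/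
structure IsMesh {d : ℕ} (Γ : Set (Eucl d)) (𝒯 : Set (Set (Eucl d))) : Prop where
  finite : 𝒯.Finite
  /-- Elements are bi-Lipschitz images of compact Lipschitz domains in `ℝᵈ⁻¹`. -/
  element : ∀ T ∈ 𝒯, ∃ (U : Set (Eucl (d - 1))) (γ : Eucl (d - 1) → Eucl d),
    IsBoundedLipschitzDomain U ∧ BiLipschitzOn γ (closure U) ∧ T = γ '' closure U
  cover : ⋃₀ 𝒯 = Γ
  overlap : ∀ T ∈ 𝒯, ∀ T' ∈ 𝒯, T ≠ T' → surfaceMeasure Γ (T ∩ T') = 0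

/-- The size `h_T = |T|^{1/(d-1)}`. -/
def elementSize {d : ℕ} (Γ T : Set (Eucl d)) : ℝ :=
  (surfaceMeasure Γ T).toReal ^ (1 / ((d : ℝ) - 1))

/-- The mesh-width function, equal to `h_T` on `T`. (On the null set of points that lie in several
elements, the largest of the values is taken.) -/
def meshWidth {d : ℕ} (Γ : Set (Eucl d)) (𝒯 : Set (Set (Eucl d))) (x : Eucl d) : ℝ :=
  sSup {h | ∃ T ∈ 𝒯, x ∈ T ∧ h = elementSize Γ T}

/-- The patch `π^q(ω)`. -/
def patch {d : ℕ} (𝒯 : Set (Set (Eucl d))) : ℕ → Set (Eucl d) → Set (Eucl d)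
  | 0, ω => ω
  | q + 1, ω => ⋃₀ {T ∈ 𝒯 | (T ∩ patch 𝒯 q ω).Nonempty}

/-- The set of elements `Π^q(ω)`. -/
def patchElements {d : ℕ} (𝒯 : Set (Set (Eucl d))) (q : ℕ) (ω : Set (Eucl d)) :
    Set (Set (Eucl d)) :=
  {T ∈ 𝒯 | T ⊆ patch 𝒯 q ω}

open Classical in
/-- `dist(T, Γ \ π(T))`, with the convention `dist(T, ∅) = diam(Γ)`. -/
def patchDist {d : ℕ} (Γ : Set (Eucl d)) (𝒯 : Set (Set (Eucl d))) (T : Set (Eucl d)) : ℝ :=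
  if (Γ \ patch 𝒯 1 T).Nonempty then sInf (Set.image2 dist T (Γ \ patch 𝒯 1 T))
  else Metric.diam Γ

/-- Bounded element patch. -/
def BoundedPatch {d : ℕ} (𝒯 : Set (Set (Eucl d))) (C : ℝ) : Prop :=
  ∀ T ∈ 𝒯, ((patchElements 𝒯 1 T).ncard : ℝ) ≤ C

/-- Local quasi-uniformity. -/
def LocallyQuasiUniform {d : ℕ} (𝒯 : Set (Set (Eucl d))) (C : ℝ) : Prop :=
  ∀ T ∈ 𝒯, ∀ T' ∈ patchElements 𝒯 1 T, Metric.diam T / Metric.diam T' ≤ C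

/-- Shape-regularity. -/
def ShapeRegular {d : ℕ} (Γ : Set (Eucl d)) (𝒯 : Set (Set (Eucl d))) (C : ℝ) : Prop :=
  ∀ T ∈ 𝒯, C⁻¹ ≤ Metric.diam T / elementSize Γ T ∧ Metric.diam T / elementSize Γ T ≤ C

/-- Elements lie in the center of their patches. -/
def CenteredInPatches {d : ℕ} (Γ : Set (Eucl d)) (𝒯 : Set (Set (Eucl d))) (C : ℝ) : Prop :=
  ∀ T ∈ 𝒯, Metric.diam T ≤ C * patchDist Γ 𝒯 T

/-- Local seminorm estimate: `|v|_{H^{1/2}(π(z))} ≤ C diam(π(z))^{1/2} ‖∇_Γ v‖_{L²(π(z))}` for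
all `v ∈ H¹(Γ)` and `z ∈ Γ`. -/
def LocalSeminormEstimate {d : ℕ} (Γ : Set (Eucl d)) (𝒯 : Set (Set (Eucl d))) (C : ℝ) : Prop :=
  ∀ (v : L2 Γ) (g : L2Field Γ), HasSurfaceGradient Γ v g → ∀ z ∈ Γ,
    slobodeckijSeminorm Γ (1 / 2) (patch 𝒯 1 {z}) v ≤
      ENNReal.ofReal (C * √(Metric.diam (patch 𝒯 1 {z}))) *
        eLpNorm g 2 ((surfaceMeasure Γ).restrict (patch 𝒯 1 {z}))

/-! ### Approximation of unity -/

/-- The support of (the class) `ψ ∈ L²(Γ)`: the complement of the largest open set on which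
`ψ = 0` almost everywhere. -/
def essSupport {d : ℕ} {Γ : Set (Eucl d)} (ψ : L2 Γ) : Set (Eucl d) :=
  {x | ∀ O ∈ 𝓝 x, ¬ ∀ᵐ y ∂((surfaceMeasure Γ).restrict O), ψ y = 0}

/-- The support of a vector-valued function: the union of the supports of its components. -/
def vecSupport {d D : ℕ} {Γ : Set (Eucl d)} (ψ : Fin D → L2 Γ) : Set (Eucl d) :=
  ⋃ j, essSupport (ψ j)

/-- The functions `Ψ T j`, `T ∈ 𝒯`, `j = 1, …, D`, lie in the space `X` and form a componentwise
local approximation of unity, with constants `q` and `ρ`. -/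
structure ApproximatesUnity {d D : ℕ} (Γ : Set (Eucl d)) (𝒯 : Set (Set (Eucl d)))
    (X : Submodule ℂ (Fin D → L2 Γ)) (q : ℕ) (ρ : ℝ)
    (Ψ : Set (Eucl d) → Fin D → (Fin D → L2 Γ)) : Prop where
  mem : ∀ T ∈ 𝒯, ∀ j, Ψ T j ∈ X
  subset_support : ∀ T ∈ 𝒯, ∀ j, T ⊆ vecSupport (Ψ T j)
  support_subset : ∀ T ∈ 𝒯, ∀ j, vecSupport (Ψ T j) ⊆ patch 𝒯 q T
  other_components : ∀ T ∈ 𝒯, ∀ j j', j' ≠ j → Ψ T j j' = 0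
  approx : ∀ T ∈ 𝒯, ∀ j,
    eLpNorm (fun x => 1 - Ψ T j j x) 2 ((surfaceMeasure Γ).restrict (vecSupport (Ψ T j))) ≤
      ENNReal.ofReal ρ * (surfaceMeasure Γ (essSupport (Ψ T j j))) ^ (1 / 2 : ℝ)

/-- The norm `‖h^{1/2} ∇_Γ v‖_{L²(Γ)}`, where `g j = ∇_Γ v_j`, with values in `[0, ∞]`. -/
def weightedGradientNorm {d D : ℕ} (Γ : Set (Eucl d)) (𝒯 : Set (Set (Eucl d)))
    (g : Fin D → L2Field Γ) : ℝ≥0∞ :=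
  (∑ j, eLpNorm (fun x => √(meshWidth Γ 𝒯 x) • g j x) 2 (surfaceMeasure Γ) ^ 2) ^ (1 / 2 : ℝ)

end BEM

end

/-!
The boundary `Γ` is covered by finitely many Lipschitz graphs, so balls of radius `r` have surface
measure `O(r^(d-1))`, and the kernel `|x - y|^(-d)` integrates to `O(1/δ)` over `|x - y| ≥ δ`
(`IsBoundedLipschitzDomain.exists_surfaceMeasure_closedBall_le`, `lintegral_inv_edist_pow_le`).
This localizes the seminorm: the interaction of two elements that do not touch is bounded by
`diam(T)⁻¹ ‖v‖²_{L²(T)}`, since an element has a distance of at least a multiple of its diameter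
from the complement of its patch, while touching elements lie in a common node patch, where the
local seminorm estimate applies (`IsRegularMesh.slobodeckijEnergy_le`,
`IsRegularMesh.slobodeckijEnergy_neighbor_le`).

It remains to bound the sum of `diam(T)⁻¹ ‖v‖²_{L²(T)}` by the weighted gradient; the global
`L²`-norm is then controlled as well, because `diam(T) ≤ diam(Γ)`. Mean values are avoided, and
all Poincaré type estimates are phrased in terms of the integrals `sqDifference` of
`|v(x) - v(y)|²` over products of sets, which satisfy a triangle inequality after normalization.
On pairs of neighbours they are bounded by the seminorm, hence by the gradient. The triangle
inequality extends the bound to `T × π^q(T)`, with a loss that depends only on `q` and the mesh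
constants (`IsRegularMesh.sum_sqDifference_patch_le`). Finally, `⟨v, ψ⟩ = 0` means that
`conj (v(x)) ∫ ψ` is the integral of `conj (v(x) - v(y)) ψ(y)` over the support `S` of `ψ`. As `ψ`
is close to `1` on `S`, its integral is comparable to `|S|`, and `‖v‖²_{L²(T)}` is bounded by
`sqDifference` on `T × S`, divided by `|S|` (`measure_mul_lintegral_sq_le_sqDifference`).

All estimates take place in `[0, ∞]`, so that no integrability of the kernels has to be known
beforehand.
-/

noncomputable section
namespace BEM

/-! ### Surface measure of balls -/

/-- The part in a ball of radius `r` of the graph of a `K`-Lipschitz function is the image, under a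
`(1 + K)`-Lipschitz map, of a ball of radius `r` in the parameter space. -/
lemma euclideanHausdorffMeasure_graph_inter_closedBall_le {n : ℕ}
    (e : Eucl n ≃ᵃⁱ[ℝ] WithLp 2 (Eucl (n - 1) × ℝ)) {ζ : Eucl (n - 1) → ℝ} {K : ℝ≥0}
    (hζ : LipschitzWith K ζ) (x : Eucl n) {r : ℝ} (hr : 0 ≤ r) :
    Measure.euclideanHausdorffMeasure (n - 1)
        ({y | (e y).snd = ζ (e y).fst} ∩ Metric.closedBall x r) ≤
      ((1 + K : ℝ≥0) : ℝ≥0∞) ^ (n - 1) * volume (Metric.ball (0 : Eucl (n - 1)) 1) *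
        ENNReal.ofReal r ^ (n - 1) := by
  have hf : LipschitzWith (1 + K) (fun y : Eucl (n - 1) => e.symm (WithLp.toLp 2 (y, ζ y))) := by
    refine LipschitzWith.of_dist_le_mul fun y z => ?_
    rw [e.symm.dist_map, WithLp.prod_dist_eq_of_L2]
    have h1 := hζ.dist_le_mul y z
    simp only [NNReal.coe_add, NNReal.coe_one]
    refine Real.sqrt_le_iff.2 ⟨by positivity, ?_⟩
    have h2 : dist (ζ y) (ζ z) ^ 2 ≤ (K * dist y z) ^ 2 := by gcongr
    change dist y z ^ 2 + dist (ζ y) (ζ z) ^ 2 ≤ _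
    nlinarith [mul_nonneg K.coe_nonneg (sq_nonneg (dist y z))]
  have hsub : {y | (e y).snd = ζ (e y).fst} ∩ Metric.closedBall x r ⊆
      (fun y : Eucl (n - 1) => e.symm (WithLp.toLp 2 (y, ζ y))) ''
        Metric.closedBall (e x).fst r := by
    rintro y ⟨hy, hyr⟩
    refine ⟨(e y).fst, ?_, ?_⟩
    · rw [Metric.mem_closedBall] at hyr ⊢
      refine le_trans ?_ hyr
      rw [← e.dist_map, WithLp.prod_dist_eq_of_L2]
      exact Real.le_sqrt_of_sq_le (le_add_of_nonneg_right (sq_nonneg _))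
    · have : WithLp.toLp 2 ((e y).fst, ζ (e y).fst) = e y := by
        rw [← (show (e y).snd = ζ (e y).fst from hy)]; rfl
      simp [this]
  calc _ ≤ _ := measure_mono hsub
    _ ≤ ((1 + K : ℝ≥0) : ℝ≥0∞) ^ (n - 1) *
        Measure.euclideanHausdorffMeasure (n - 1) (Metric.closedBall (e x).fst r) := by
      rw [Measure.euclideanHausdorffMeasure_def, Measure.euclideanHausdorffMeasure_def,
        Measure.smul_apply, Measure.smul_apply, ENNReal.smul_def, ENNReal.smul_def,
        smul_eq_mul, smul_eq_mul, mul_left_comm]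
      gcongr
      simpa using hf.hausdorffMeasure_image_le (d := ((n - 1 : ℕ) : ℝ)) (by positivity)
        (Metric.closedBall (e x).fst r)
    _ = _ := by
      rw [EuclideanSpace.euclideanHausdorffMeasure_eq_volume, Measure.addHaar_closedBall _ _ hr,
        ENNReal.ofReal_pow hr]
      simp only [finrank_euclideanSpace, Fintype.card_fin]
      ring

/-- The surface measure of the boundary of a bounded Lipschitz domain is upper Ahlfors regular:
the boundary is covered by finitely many Lipschitz graphs. -/
lemma IsBoundedLipschitzDomain.exists_surfaceMeasure_closedBall_le {n : ℕ} {Ω : Set (Eucl n)}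
    (hΩ : IsBoundedLipschitzDomain Ω) :
    ∃ A : ℝ≥0, ∀ (x : Eucl n) (r : ℝ), 0 ≤ r →
      surfaceMeasure (frontier Ω) (Metric.closedBall x r) ≤ A * ENNReal.ofReal r ^ (n - 1) := by
  have hcomp : IsCompact (frontier Ω) :=
    Metric.isCompact_of_isClosed_isBounded isClosed_frontier
      (hΩ.isBounded.closure.subset frontier_subset_closure)
  choose! W H hWo hxW hH hWH using hΩ.locally_hypograph
  obtain ⟨t, ht, hcov⟩ := hcomp.elim_nhds_subcover W
    fun x hx => (hWo x hx).mem_nhds (hxW x hx)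
  have hloc : ∀ z ∈ t, ∃ B : ℝ≥0, ∀ (x : Eucl n) (r : ℝ), 0 ≤ r →
      Measure.euclideanHausdorffMeasure (n - 1) (W z ∩ frontier Ω ∩ Metric.closedBall x r) ≤
        B * ENNReal.ofReal r ^ (n - 1) := by
    intro z hz
    obtain ⟨e, ζ, K, hζ, hHe⟩ := hH z (ht z hz)
    refine ⟨(1 + K) ^ (n - 1) * (volume (Metric.ball (0 : Eucl (n - 1)) 1)).toNNReal,
      fun x r hr => ?_⟩
    have hfr : W z ∩ frontier Ω ⊆ {y | (e y).snd = ζ (e y).fst} := by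
      intro y hy
      have h1 : y ∈ frontier (H z) := by
        have h2 : W z ∩ frontier Ω = W z ∩ frontier (H z) := by
          have hWz := hWo z (ht z hz)
          rw [Set.inter_comm, ← frontier_inter_open_inter hWz, Set.inter_comm Ω,
            hWH z (ht z hz), Set.inter_comm (W z) (H z), frontier_inter_open_inter hWz,
            Set.inter_comm]
        exact (h2 ▸ hy).2
      rw [hHe] at h1
      have hc1 : Continuous fun y => (e y).fst :=
        (WithLp.continuous_fst _ _ _).comp e.continuous
      have hc2 : Continuous fun y => (e y).snd :=
        (WithLp.continuous_snd _ _ _).comp e.continuous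
      exact frontier_lt_subset_eq hc2 (hζ.continuous.comp hc1) h1
    refine (measure_mono (Set.inter_subset_inter_left _ hfr)).trans ?_
    refine (euclideanHausdorffMeasure_graph_inter_closedBall_le e hζ x hr).trans ?_
    rw [ENNReal.coe_mul, ENNReal.coe_toNNReal Metric.isBounded_ball.measure_lt_top.ne,
      ENNReal.coe_pow]
  choose! B hB using hloc
  refine ⟨∑ z ∈ t, B z, fun x r hr => ?_⟩
  rw [surfaceMeasure, Measure.restrict_apply measurableSet_closedBall]
  have hsub : Metric.closedBall x r ∩ frontier Ω ⊆
      ⋃ z ∈ t, W z ∩ frontier Ω ∩ Metric.closedBall x r := by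
    intro y hy
    obtain ⟨z, hz, hyz⟩ := Set.mem_iUnion₂.1 (hcov hy.2)
    exact Set.mem_iUnion₂.2 ⟨z, hz, ⟨hyz, hy.2⟩, hy.1⟩
  calc _ ≤ _ := measure_mono hsub
    _ ≤ _ := measure_biUnion_finset_le _ _
    _ ≤ ∑ z ∈ t, B z * ENNReal.ofReal r ^ (n - 1) := Finset.sum_le_sum fun z hz => hB z hz x r hr
    _ = _ := by rw [ENNReal.ofNNReal_finsetSum, Finset.sum_mul]

/-! ### Singular integrals and mean square differences -/

/-- If `μ` is upper Ahlfors regular of dimension `m`, then `dist(x, ·)^{-(m+1)}` is integrable away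
from `x`. The integral is estimated on dyadic annuli. -/
lemma lintegral_inv_edist_pow_le {X : Type*} [MetricSpace X] [MeasurableSpace X]
    [OpensMeasurableSpace X] {μ : Measure X} {A : ℝ≥0∞} {m : ℕ}
    (hA : ∀ (x : X) (r : ℝ), 0 ≤ r →
      μ (Metric.closedBall x r) ≤ A * ENNReal.ofReal r ^ m)
    (x : X) {δ : ℝ} (hδ : 0 < δ) :
    ∫⁻ y in {y | δ ≤ dist x y}, (edist x y ^ (m + 1))⁻¹ ∂μ ≤
      A * 2 ^ (m + 1) * (ENNReal.ofReal δ)⁻¹ := by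
  set R : ℕ → Set X := fun k => {y | 2 ^ k * δ ≤ dist x y ∧ dist x y < 2 ^ (k + 1) * δ} with hR
  have hcov : {y | δ ≤ dist x y} ⊆ ⋃ k, R k := by
    intro y hy
    obtain ⟨k, hk1, hk2⟩ := exists_nat_pow_near (x := dist x y / δ) (y := 2)
      ((one_le_div hδ).2 hy) one_lt_two
    exact Set.mem_iUnion.2 ⟨k, (le_div_iff₀ hδ).1 hk1, (div_lt_iff₀ hδ).1 hk2⟩
  have hannulus : ∀ k, ∫⁻ y in R k, (edist x y ^ (m + 1))⁻¹ ∂μ ≤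
      A * 2 ^ m * (ENNReal.ofReal δ)⁻¹ * (2⁻¹ : ℝ≥0∞) ^ k := by
    intro k
    have hRm : MeasurableSet (R k) := by
      apply MeasurableSet.inter
      · exact (isClosed_le continuous_const (continuous_const.dist continuous_id)).measurableSet
      · exact (isOpen_lt (continuous_const.dist continuous_id) continuous_const).measurableSet
    have hkδ : 0 < 2 ^ k * δ := by positivity
    have hδ0 : ENNReal.ofReal δ ≠ 0 := by simpa using hδ
    calc ∫⁻ y in R k, (edist x y ^ (m + 1))⁻¹ ∂μ
        ≤ ∫⁻ _ in R k, (ENNReal.ofReal (2 ^ k * δ) ^ (m + 1))⁻¹ ∂μ := by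
          refine setLIntegral_mono measurable_const fun y hy => ?_
          rw [edist_dist]
          gcongr
          exact hy.1
      _ ≤ (ENNReal.ofReal (2 ^ k * δ) ^ (m + 1))⁻¹ *
            (A * ENNReal.ofReal (2 ^ (k + 1) * δ) ^ m) := by
          rw [setLIntegral_const]
          gcongr
          refine (measure_mono fun y hy => ?_).trans (hA x _ (by positivity))
          rw [Metric.mem_closedBall, dist_comm]
          exact hy.2.le
      _ = A * 2 ^ m * (ENNReal.ofReal δ)⁻¹ * (2⁻¹ : ℝ≥0∞) ^ k := by
          have h2 : ENNReal.ofReal (2 ^ (k + 1) * δ) = 2 * ENNReal.ofReal (2 ^ k * δ) := by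
            rw [pow_succ', mul_assoc, ENNReal.ofReal_mul zero_le_two, ENNReal.ofReal_ofNat]
          have h3 : ENNReal.ofReal (2 ^ k * δ) = 2 ^ k * ENNReal.ofReal δ := by
            rw [ENNReal.ofReal_mul (by positivity), ENNReal.ofReal_pow zero_le_two,
              ENNReal.ofReal_ofNat]
          have h0 : ENNReal.ofReal (2 ^ k * δ) ≠ 0 := by simpa using hkδ
          have hinv : (2 ^ k * ENNReal.ofReal δ)⁻¹ = (2⁻¹ : ℝ≥0∞) ^ k * (ENNReal.ofReal δ)⁻¹ := by
            rw [ENNReal.mul_inv (by simp) (by simp), ENNReal.inv_pow]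
          have htop : ENNReal.ofReal (2 ^ k * δ) ≠ ∞ := ENNReal.ofReal_ne_top
          rw [h2, mul_pow, pow_succ, ENNReal.mul_inv (.inr htop) (.inr h0)]
          calc _ = A * 2 ^ m * (ENNReal.ofReal (2 ^ k * δ))⁻¹ *
              ((ENNReal.ofReal (2 ^ k * δ) ^ m)⁻¹ * ENNReal.ofReal (2 ^ k * δ) ^ m) := by ring
            _ = _ := by
              rw [ENNReal.inv_mul_cancel (pow_ne_zero _ h0) (ENNReal.pow_ne_top htop), h3, hinv]
              ring
  calc ∫⁻ y in {y | δ ≤ dist x y}, (edist x y ^ (m + 1))⁻¹ ∂μ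
      ≤ ∫⁻ y in ⋃ k, R k, (edist x y ^ (m + 1))⁻¹ ∂μ := lintegral_mono_set hcov
    _ ≤ ∑' k, ∫⁻ y in R k, (edist x y ^ (m + 1))⁻¹ ∂μ := lintegral_iUnion_le _ _
    _ ≤ ∑' k, A * 2 ^ m * (ENNReal.ofReal δ)⁻¹ * (2⁻¹ : ℝ≥0∞) ^ k := ENNReal.tsum_le_tsum hannulus
    _ = A * 2 ^ (m + 1) * (ENNReal.ofReal δ)⁻¹ := by
      rw [ENNReal.tsum_mul_left, ENNReal.tsum_geometric, ENNReal.one_sub_inv_two, inv_inv]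
      ring

section

variable {X : Type*} [MeasurableSpace X]

lemma setLIntegral_biUnion_finset_le {ι : Type*} (μ : Measure X)
    (t : Finset ι) (s : ι → Set X) (f : X → ℝ≥0∞) :
    ∫⁻ x in ⋃ i ∈ t, s i, f x ∂μ ≤ ∑ i ∈ t, ∫⁻ x in s i, f x ∂μ := by
  classical
  induction t using Finset.induction_on with
  | empty => simp
  | insert i t hi ih =>
    rw [Finset.set_biUnion_insert, Finset.sum_insert hi]
    exact (lintegral_union_le _ _ _).trans (by gcongr)

lemma eLpNorm_two_sq {E : Type*} [NormedAddCommGroup E] (μ : Measure X)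
    (f : X → E) : eLpNorm f 2 μ ^ 2 = ∫⁻ x, ‖f x‖ₑ ^ 2 ∂μ := by
  rw [eLpNorm_eq_lintegral_rpow_enorm_toReal two_ne_zero (by simp), ← ENNReal.rpow_natCast,
    ← ENNReal.rpow_mul]
  simp

/-- The integral of `|v(x) - v(y)|²` over `A × B`. -/
def sqDifference (μ : Measure X) (v : X → ℂ) (A B : Set X) : ℝ≥0∞ :=
  ∫⁻ x in A, ∫⁻ y in B, ‖v x - v y‖ₑ ^ 2 ∂μ ∂μ

lemma enorm_sub_sq_le (a b c : ℂ) :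
    ‖a - c‖ₑ ^ 2 ≤ 2 * ‖a - b‖ₑ ^ 2 + 2 * ‖c - b‖ₑ ^ 2 := by
  have h : ‖a - c‖ₑ ≤ ‖a - b‖ₑ + ‖c - b‖ₑ := by
    rw [← edist_eq_enorm_sub, ← edist_eq_enorm_sub, ← edist_eq_enorm_sub]
    exact edist_triangle_right a c b
  calc ‖a - c‖ₑ ^ 2 ≤ (‖a - b‖ₑ + ‖c - b‖ₑ) ^ 2 := by gcongr
    _ ≤ _ := by
      have := ENNReal.rpow_add_le_mul_rpow_add_rpow ‖a - b‖ₑ ‖c - b‖ₑ (p := 2) one_le_two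
      norm_num at this
      rwa [mul_add] at this

lemma measurable_enorm_sub_sq {v : X → ℂ} (hv : Measurable v) :
    Measurable fun p : X × X => ‖v p.1 - v p.2‖ₑ ^ 2 := by
  fun_prop

lemma sqDifference_comm (μ : Measure X) [SFinite μ] {v : X → ℂ} (hv : Measurable v)
    (A B : Set X) : sqDifference μ v A B = sqDifference μ v B A := by
  unfold sqDifference
  rw [lintegral_lintegral_swap (measurable_enorm_sub_sq hv).aemeasurable]
  simp_rw [enorm_sub_rev]

/-- A triangle inequality for the mean square differences `sqDifference μ v A B / (μ A * μ B)`. -/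
lemma measure_mul_sqDifference_le (μ : Measure X) [SFinite μ] {v : X → ℂ} (hv : Measurable v)
    (A B C : Set X) :
    μ B * sqDifference μ v A C ≤
      2 * μ C * sqDifference μ v A B + 2 * μ A * sqDifference μ v B C := by
  rw [sqDifference_comm μ hv B C]
  have hm : Measurable fun x => ∫⁻ y in B, ‖v x - v y‖ₑ ^ 2 ∂μ :=
    (measurable_enorm_sub_sq hv).lintegral_prod_right'
  have hpt : ∀ x z, μ B * ‖v x - v z‖ₑ ^ 2 ≤
      2 * ∫⁻ y in B, ‖v x - v y‖ₑ ^ 2 ∂μ + 2 * ∫⁻ y in B, ‖v z - v y‖ₑ ^ 2 ∂μ := by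
    intro x z
    rw [← lintegral_const_mul _ (by fun_prop), ← lintegral_const_mul _ (by fun_prop),
      ← lintegral_add_left (by fun_prop), mul_comm, ← setLIntegral_const]
    exact lintegral_mono fun y => enorm_sub_sq_le _ _ _
  unfold sqDifference
  calc μ B * ∫⁻ x in A, ∫⁻ z in C, ‖v x - v z‖ₑ ^ 2 ∂μ ∂μ
      = ∫⁻ x in A, ∫⁻ z in C, μ B * ‖v x - v z‖ₑ ^ 2 ∂μ ∂μ := by
        rw [← lintegral_const_mul _ (measurable_enorm_sub_sq hv).lintegral_prod_right']
        refine lintegral_congr fun x => ?_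
        rw [← lintegral_const_mul _ (by fun_prop)]
    _ ≤ ∫⁻ x in A, ∫⁻ z in C, (2 * ∫⁻ y in B, ‖v x - v y‖ₑ ^ 2 ∂μ +
          2 * ∫⁻ y in B, ‖v z - v y‖ₑ ^ 2 ∂μ) ∂μ ∂μ :=
        lintegral_mono fun x => lintegral_mono fun z => hpt x z
    _ = _ := by
        simp_rw [lintegral_add_left (measurable_const : Measurable fun _ : X => _),
          setLIntegral_const]
        rw [lintegral_add_right _ measurable_const, setLIntegral_const,
          lintegral_const_mul _ hm, lintegral_mul_const _ (hm.const_mul 2),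
          lintegral_const_mul _ hm]
        ring

/-- If `v` is orthogonal to a function `ψ` supported in `S` that is close to `1` on `S`, then `v` is
controlled by its mean square differences: by orthogonality, `conj (v(x)) ∫_S ψ` is the integral
of `conj (v(x) - v(y)) ψ(y)` over `y ∈ S`, and `|∫_S ψ| ≥ (1 - ρ) μ(S)`. -/
lemma measure_mul_lintegral_sq_le_sqDifference (μ : Measure X) {v ψ : X → ℂ} (hv : Measurable v)
    (hv2 : MemLp v 2 μ) (hψ2 : MemLp ψ 2 μ) [SFinite μ] {S : Set X}
    (hS0 : μ S ≠ 0) (hSfin : μ S ≠ ∞) (hψS : ∀ᵐ x ∂μ, x ∉ S → ψ x = 0)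
    (horth : ∫ x, inner ℂ (v x) (ψ x) ∂μ = 0) {ρ : ℝ} (hρ0 : 0 ≤ ρ)
    (hψ1 : eLpNorm (fun x => 1 - ψ x) 2 (μ.restrict S) ≤
      ENNReal.ofReal ρ * μ S ^ (1 / 2 : ℝ)) (T : Set X) :
    ENNReal.ofReal (1 - ρ) ^ 2 * μ S * ∫⁻ x in T, ‖v x‖ₑ ^ 2 ∂μ ≤
      ENNReal.ofReal (1 + ρ) ^ 2 * sqDifference μ v T S := by
  have : IsFiniteMeasure (μ.restrict S) := ⟨by simpa using hSfin.lt_top⟩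
  have hψS2 : MemLp ψ 2 (μ.restrict S) := hψ2.restrict S
  have hvS2 : MemLp v 2 (μ.restrict S) := hv2.restrict S
  have hψi : Integrable ψ (μ.restrict S) := hψS2.integrable one_le_two
  have hsqrt : μ S ^ (1 / 2 : ℝ) * μ S ^ (1 / 2 : ℝ) = μ S := by
    rw [← ENNReal.rpow_add_of_nonneg _ _ (by norm_num) (by norm_num)]; norm_num
  -- the integral of `ψ` over `S` is at least `(1 - ρ) μ S`
  have hint : ENNReal.ofReal (1 - ρ) * μ S ≤ ‖∫ x in S, ψ x ∂μ‖ₑ := by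
    have h1 : μ S ≤ ‖∫ x in S, ψ x ∂μ‖ₑ + ENNReal.ofReal ρ * μ S := by
      have e1 : ∫ x in S, ψ x ∂μ + ∫ x in S, (1 - ψ x) ∂μ = ((μ S).toReal : ℂ) := by
        rw [← integral_add hψi (g := fun x => 1 - ψ x) ((integrable_const (1 : ℂ)).sub hψi)]
        simp [Measure.real]
      have e2 : ‖∫ x in S, (1 - ψ x) ∂μ‖ₑ ≤ ENNReal.ofReal ρ * μ S := by
        calc _ ≤ ∫⁻ x in S, ‖1 - ψ x‖ₑ ∂μ := enorm_integral_le_lintegral_enorm _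
          _ = eLpNorm (fun x => 1 - ψ x) 1 (μ.restrict S) := by rw [eLpNorm_one_eq_lintegral_enorm]
          _ ≤ eLpNorm (fun x => 1 - ψ x) 2 (μ.restrict S) * μ S ^ (1 / 2 : ℝ) := by
            have := eLpNorm_le_eLpNorm_mul_rpow_measure_univ (μ := μ.restrict S) one_le_two
              (aestronglyMeasurable_const.sub hψS2.1 :
                AEStronglyMeasurable (fun x => (1 : ℂ) - ψ x) _)
            norm_num at this ⊢
            exact this
          _ ≤ ENNReal.ofReal ρ * μ S ^ (1 / 2 : ℝ) * μ S ^ (1 / 2 : ℝ) := by gcongr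
          _ = _ := by rw [mul_assoc, hsqrt]
      calc μ S = ‖((μ S).toReal : ℂ)‖ₑ := by
            rw [← ofReal_norm]
            simp [ENNReal.ofReal_toReal hSfin]
        _ ≤ ‖∫ x in S, ψ x ∂μ‖ₑ + ‖∫ x in S, (1 - ψ x) ∂μ‖ₑ := by
            rw [← e1]; exact enorm_add_le _ _
        _ ≤ _ := by gcongr
    rw [ENNReal.ofReal_sub _ hρ0, ENNReal.ofReal_one,
      ENNReal.sub_mul (fun _ _ => hSfin), one_mul]
    exact tsub_le_iff_right.2 h1
  have hnorm : eLpNorm ψ 2 (μ.restrict S) ≤ ENNReal.ofReal (1 + ρ) * μ S ^ (1 / 2 : ℝ) := by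
    calc eLpNorm ψ 2 (μ.restrict S)
        = eLpNorm ((fun _ => 1) - fun x => 1 - ψ x) 2 (μ.restrict S) := by
          congr 1; ext x; simp
      _ ≤ eLpNorm (fun _ => (1 : ℂ)) 2 (μ.restrict S) +
          eLpNorm (fun x => 1 - ψ x) 2 (μ.restrict S) :=
          eLpNorm_sub_le aestronglyMeasurable_const (aestronglyMeasurable_const.sub hψS2.1)
            one_le_two
      _ ≤ μ S ^ (1 / 2 : ℝ) + ENNReal.ofReal ρ * μ S ^ (1 / 2 : ℝ) := by
          gcongr
          rw [eLpNorm_const' _ two_ne_zero (by simp)]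
          simp
      _ = _ := by rw [ENNReal.ofReal_add zero_le_one hρ0, ENNReal.ofReal_one]; ring
  have horthS : ∫ y in S, inner ℂ (v y) (ψ y) ∂μ = 0 := by
    rw [setIntegral_eq_integral_of_ae_compl_eq_zero, horth]
    filter_upwards [hψS] with y hy hyS
    simp [hy hyS]
  have hpt : ∀ x, ENNReal.ofReal (1 - ρ) ^ 2 * μ S * ‖v x‖ₑ ^ 2 ≤
      ENNReal.ofReal (1 + ρ) ^ 2 * ∫⁻ y in S, ‖v x - v y‖ₑ ^ 2 ∂μ := by
    intro x
    set N := (∫⁻ y in S, ‖v x - v y‖ₑ ^ (2 : ℝ) ∂μ) ^ (1 / 2 : ℝ) with hN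
    have hN2 : N ^ 2 = ∫⁻ y in S, ‖v x - v y‖ₑ ^ 2 ∂μ := by
      rw [hN, ← ENNReal.rpow_natCast, ← ENNReal.rpow_mul]
      norm_num
    have h1 : ‖v x‖ₑ * ‖∫ y in S, ψ y ∂μ‖ₑ ≤ N * eLpNorm ψ 2 (μ.restrict S) := by
      have e1 : (starRingEnd ℂ (v x)) * ∫ y in S, ψ y ∂μ =
          ∫ y in S, (starRingEnd ℂ (v x - v y)) * ψ y ∂μ := by
        have hi : Integrable (fun y => inner ℂ (v y) (ψ y)) (μ.restrict S) := by
          simp_rw [RCLike.inner_apply']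
          exact hvS2.star.integrable_mul hψS2
        have : ∀ y, (starRingEnd ℂ (v x - v y)) * ψ y =
            (starRingEnd ℂ (v x)) * ψ y - inner ℂ (v y) (ψ y) := by
          intro y; rw [map_sub, sub_mul, RCLike.inner_apply']
        simp_rw [this]
        rw [integral_sub (hψi.const_mul _) hi, horthS, sub_zero, integral_const_mul]
      calc ‖v x‖ₑ * ‖∫ y in S, ψ y ∂μ‖ₑ
          = ‖(starRingEnd ℂ (v x)) * ∫ y in S, ψ y ∂μ‖ₑ := by
            rw [enorm_mul, RCLike.enorm_conj]
        _ ≤ ∫⁻ y in S, ‖v x - v y‖ₑ * ‖ψ y‖ₑ ∂μ := by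
            rw [e1]
            refine (enorm_integral_le_lintegral_enorm _).trans (lintegral_mono fun y => ?_)
            rw [enorm_mul, RCLike.enorm_conj]
        _ ≤ N * (∫⁻ y in S, ‖ψ y‖ₑ ^ (2 : ℝ) ∂μ) ^ (1 / 2 : ℝ) :=
            ENNReal.lintegral_mul_le_Lp_mul_Lq _ Real.HolderConjugate.two_two
              (by fun_prop) hψS2.1.enorm
        _ = _ := by
            rw [eLpNorm_eq_lintegral_rpow_enorm_toReal two_ne_zero (by simp)]
            simp
    have h2 : ENNReal.ofReal (1 - ρ) * μ S * ‖v x‖ₑ ≤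
        N * (ENNReal.ofReal (1 + ρ) * μ S ^ (1 / 2 : ℝ)) := by
      calc _ ≤ ‖∫ y in S, ψ y ∂μ‖ₑ * ‖v x‖ₑ := by gcongr
        _ = _ := mul_comm _ _
        _ ≤ _ := h1
        _ ≤ _ := by gcongr
    have h3 : (ENNReal.ofReal (1 - ρ) * μ S * ‖v x‖ₑ) ^ 2 ≤
        (N * (ENNReal.ofReal (1 + ρ) * μ S ^ (1 / 2 : ℝ))) ^ 2 := by gcongr
    rw [← ENNReal.mul_le_mul_iff_right hS0 hSfin]
    calc _ = (ENNReal.ofReal (1 - ρ) * μ S * ‖v x‖ₑ) ^ 2 := by ring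
      _ ≤ _ := h3
      _ = N ^ 2 * ENNReal.ofReal (1 + ρ) ^ 2 * (μ S ^ (1 / 2 : ℝ) * μ S ^ (1 / 2 : ℝ)) := by ring
      _ = _ := by rw [hsqrt, hN2]; ring
  unfold sqDifference
  rw [← lintegral_const_mul _ (by fun_prop),
    ← lintegral_const_mul _ (measurable_enorm_sub_sq hv).lintegral_prod_right']
  exact lintegral_mono fun x => hpt x

end

/-! ### Elements and neighbours of a mesh -/

variable {d : ℕ} {Γ : Set (Eucl d)} {𝒯 : Set (Set (Eucl d))}

lemma IsMesh.isCompact (h : IsMesh Γ 𝒯) {T : Set (Eucl d)} (hT : T ∈ 𝒯) : IsCompact T := by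
  obtain ⟨U, γ, hU, ⟨K, hK, -⟩, rfl⟩ := h.element T hT
  exact (Metric.isCompact_of_isClosed_isBounded isClosed_closure
    hU.isBounded.closure).image_of_continuousOn hK.continuousOn

lemma IsMesh.measurableSet (h : IsMesh Γ 𝒯) {T : Set (Eucl d)} (hT : T ∈ 𝒯) : MeasurableSet T :=
  (h.isCompact hT).measurableSet

lemma IsMesh.subset (h : IsMesh Γ 𝒯) {T : Set (Eucl d)} (hT : T ∈ 𝒯) : T ⊆ Γ := by
  rw [← h.cover]; exact Set.subset_sUnion_of_mem hT

/-- The mesh as a `Finset`. -/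
def IsMesh.elements (h : IsMesh Γ 𝒯) : Finset (Set (Eucl d)) := h.finite.toFinset

@[simp] lemma IsMesh.mem_elements (h : IsMesh Γ 𝒯) {T : Set (Eucl d)} :
    T ∈ h.elements ↔ T ∈ 𝒯 := h.finite.mem_toFinset

open Classical in
/-- The elements that intersect `T`, including `T` itself if it is a nonempty element. -/
def IsMesh.neighbors (h : IsMesh Γ 𝒯) (T : Set (Eucl d)) : Finset (Set (Eucl d)) :=
  {T' ∈ h.elements | (T ∩ T').Nonempty}

lemma IsMesh.mem_neighbors (h : IsMesh Γ 𝒯) {T T' : Set (Eucl d)} :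
    T' ∈ h.neighbors T ↔ T' ∈ 𝒯 ∧ (T ∩ T').Nonempty := by
  simp [IsMesh.neighbors]

lemma IsMesh.mem_neighbors_comm (h : IsMesh Γ 𝒯) {T T' : Set (Eucl d)} (hT : T ∈ 𝒯)
    (hT' : T' ∈ 𝒯) : T' ∈ h.neighbors T ↔ T ∈ h.neighbors T' := by
  simp [h.mem_neighbors, hT, hT', Set.inter_comm]

lemma IsMesh.patch_one_eq (h : IsMesh Γ 𝒯) (T : Set (Eucl d)) :
    patch 𝒯 1 T = ⋃ T' ∈ h.neighbors T, T' := by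
  ext x
  simp only [patch, h.mem_neighbors, Set.mem_sUnion, Set.mem_iUnion₂, Set.mem_ofPred_eq,
    Set.inter_comm T, exists_prop]

/-- The patches are defined by adding a layer of elements on the outside; here the first layer is
split off instead. -/
lemma IsMesh.patch_succ_subset (h : IsMesh Γ 𝒯) (q : ℕ) (T : Set (Eucl d)) :
    patch 𝒯 (q + 1) T ⊆ ⋃ T' ∈ h.neighbors T, patch 𝒯 q T' := by
  induction q with
  | zero => exact (h.patch_one_eq T).le
  | succ q ih =>
    rintro x ⟨T₂, ⟨hT₂, y, hy, hyT⟩, hx⟩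
    obtain ⟨T₁, hT₁, hyT₁⟩ := Set.mem_iUnion₂.1 (ih hyT)
    exact Set.mem_iUnion₂.2 ⟨T₁, hT₁, T₂, ⟨hT₂, y, hy, hyT₁⟩, hx⟩

lemma IsMesh.patch_singleton_subset (h : IsMesh Γ 𝒯) {T : Set (Eucl d)} {z : Eucl d}
    (hz : z ∈ T) : patch 𝒯 1 {z} ⊆ ⋃ T' ∈ h.neighbors T, T' := by
  rintro x ⟨T', ⟨hT', y, hy, rfl⟩, hx⟩
  exact Set.mem_iUnion₂.2 ⟨T', h.mem_neighbors.2 ⟨hT', y, hz, hy⟩, hx⟩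

lemma subset_patch_singleton {T : Set (Eucl d)} (hT : T ∈ 𝒯) {z : Eucl d} (hz : z ∈ T) :
    T ⊆ patch 𝒯 1 {z} :=
  Set.subset_sUnion_of_mem ⟨hT, z, hz, rfl⟩

lemma IsMesh.pairwise_aedisjoint (h : IsMesh Γ 𝒯) {t : Finset (Set (Eucl d))}
    (ht : t ⊆ h.elements) :
    Set.Pairwise (t : Set (Set (Eucl d))) (Function.onFun (AEDisjoint (surfaceMeasure Γ)) id) :=
  fun T hT T' hT' hne =>
    h.overlap T (h.mem_elements.1 (ht hT)) T' (h.mem_elements.1 (ht hT')) hne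

lemma IsMesh.sum_setLIntegral_eq (h : IsMesh Γ 𝒯) {t : Finset (Set (Eucl d))}
    (ht : t ⊆ h.elements) (f : Eucl d → ℝ≥0∞) :
    ∑ T ∈ t, ∫⁻ x in T, f x ∂(surfaceMeasure Γ) =
      ∫⁻ x in ⋃ T ∈ t, T, f x ∂(surfaceMeasure Γ) :=
  (lintegral_biUnion_finset₀ (h.pairwise_aedisjoint ht)
    (fun _ hT => (h.measurableSet (h.mem_elements.1 (ht hT))).nullMeasurableSet) f).symm

lemma IsMesh.biUnion_elements (h : IsMesh Γ 𝒯) : ⋃ T ∈ h.elements, T = Γ := by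
  refine Eq.trans ?_ h.cover
  rw [Set.sUnion_eq_biUnion]
  simp

/-- A mesh with its local regularity properties, in the form in which they enter the estimates:
an element has at most `N` neighbours, the diameters of neighbours differ by a factor of at most
`L`, and `diam(T)^(d-1)` and `|T|` differ by a factor of at most `K`. -/
structure IsRegularMesh (Γ : Set (Eucl d)) (𝒯 : Set (Set (Eucl d))) (N L K : ℝ≥0) : Prop where
  isMesh : IsMesh Γ 𝒯
  diam_pos : ∀ T ∈ 𝒯, 0 < Metric.diam T
  card_neighbors_le : ∀ T ∈ 𝒯, ((isMesh.neighbors T).card : ℝ≥0∞) ≤ N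
  diam_le : ∀ T ∈ 𝒯, ∀ T' ∈ 𝒯, (T ∩ T').Nonempty → Metric.diam T ≤ L * Metric.diam T'
  measure_le : ∀ T ∈ 𝒯, surfaceMeasure Γ T ≤ K * ENNReal.ofReal (Metric.diam T) ^ (d - 1)
  le_measure : ∀ T ∈ 𝒯, ENNReal.ofReal (Metric.diam T) ^ (d - 1) ≤ K * surfaceMeasure Γ T

/-- As `diam(T) / 0 = 0`, the lower bound in shape-regularity excludes elements of size zero. -/
lemma ShapeRegular.elementSize_pos {C : ℝ} (hC : 0 < C) (h : ShapeRegular Γ 𝒯 C)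
    {T : Set (Eucl d)} (hT : T ∈ 𝒯) : 0 < elementSize Γ T := by
  have h0 : 0 ≤ elementSize Γ T := Real.rpow_nonneg ENNReal.toReal_nonneg _
  refine h0.lt_of_ne' fun h1 => ?_
  have h2 := (h T hT).1
  rw [h1, div_zero] at h2
  exact absurd (inv_pos.2 hC) h2.not_gt

lemma ShapeRegular.diam_le {C : ℝ} (hC : 0 < C) (h : ShapeRegular Γ 𝒯 C)
    {T : Set (Eucl d)} (hT : T ∈ 𝒯) : Metric.diam T ≤ C * elementSize Γ T :=
  (div_le_iff₀ (h.elementSize_pos hC hT)).1 (h T hT).2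

lemma ShapeRegular.elementSize_le {C : ℝ} (hC : 0 < C) (h : ShapeRegular Γ 𝒯 C)
    {T : Set (Eucl d)} (hT : T ∈ 𝒯) : elementSize Γ T ≤ C * Metric.diam T := by
  have h1 := (le_div_iff₀ (h.elementSize_pos hC hT)).1 (h T hT).1
  rwa [inv_mul_le_iff₀ hC] at h1

lemma IsMesh.isRegularMesh (hd : 2 ≤ d) (h : IsMesh Γ 𝒯) {Cpatch Clocuni Cshape : ℝ}
    (hlocuni : 0 < Clocuni) (hshape : 0 < Cshape) (h1 : BoundedPatch 𝒯 Cpatch)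
    (h2 : LocallyQuasiUniform 𝒯 Clocuni) (h3 : ShapeRegular Γ 𝒯 Cshape) :
    IsRegularMesh Γ 𝒯 Cpatch.toNNReal Clocuni.toNNReal (Cshape.toNNReal ^ (d - 1)) := by
  have hsub : ∀ T, ∀ T' ∈ h.neighbors T, T' ∈ patchElements 𝒯 1 T := by
    intro T T' hT'
    refine ⟨(h.mem_neighbors.1 hT').1, ?_⟩
    rw [h.patch_one_eq]
    exact Set.subset_biUnion_of_mem (u := fun T => T) hT'
  have hpos : ∀ T ∈ 𝒯, 0 < Metric.diam T := fun T hT =>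
    pos_of_mul_pos_right ((h3.elementSize_pos hshape hT).trans_le (h3.elementSize_le hshape hT))
      hshape.le
  have hsize : ∀ T ∈ 𝒯, elementSize Γ T ^ (d - 1) = (surfaceMeasure Γ T).toReal := by
    intro T hT
    have hd1 : ((d : ℝ) - 1) = ((d - 1 : ℕ) : ℝ) := by
      rw [Nat.cast_sub (by omega), Nat.cast_one]
    rw [elementSize, hd1, one_div, Real.rpow_inv_natCast_pow ENNReal.toReal_nonneg (by omega)]
  -- an element of infinite measure would have the size `∞.toReal ^ _ = 0`
  have hfin : ∀ T ∈ 𝒯, surfaceMeasure Γ T ≠ ∞ := by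
    intro T hT htop
    have := hsize T hT
    rw [htop, ENNReal.toReal_top] at this
    exact (pow_pos (h3.elementSize_pos hshape hT) _).ne' this
  refine ⟨h, hpos, fun T hT => ?_, fun T hT T' hT' hne => ?_, fun T hT => ?_, fun T hT => ?_⟩
  · have hfinite : (patchElements 𝒯 1 T).Finite := h.finite.subset fun _ h => h.1
    have hcard : (h.neighbors T).card ≤ (patchElements 𝒯 1 T).ncard := by
      rw [← Set.ncard_coe_finset]
      exact Set.ncard_le_ncard (fun T' hT' => hsub T T' hT') hfinite
    have : ((h.neighbors T).card : ℝ) ≤ Cpatch := (Nat.cast_le.2 hcard).trans (h1 T hT)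
    rw [← ENNReal.ofReal_natCast]
    exact ENNReal.ofReal_le_ofReal this
  · rw [Real.coe_toNNReal _ hlocuni.le]
    exact (div_le_iff₀ (hpos T' hT')).1 (h2 T hT T' (hsub T T' (h.mem_neighbors.2 ⟨hT', hne⟩)))
  · rw [← ENNReal.ofReal_toReal (hfin T hT), ← hsize T hT, ENNReal.coe_pow, ← mul_pow,
      ENNReal.ofReal_pow (h3.elementSize_pos hshape hT).le]
    gcongr
    rw [← ENNReal.ofReal, ← ENNReal.ofReal_mul hshape.le]
    exact ENNReal.ofReal_le_ofReal (h3.elementSize_le hshape hT)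
  · rw [← ENNReal.ofReal_toReal (hfin T hT), ← hsize T hT, ENNReal.coe_pow,
      ENNReal.ofReal_pow (h3.elementSize_pos hshape hT).le, ← mul_pow]
    gcongr
    rw [← ENNReal.ofReal, ← ENNReal.ofReal_mul hshape.le]
    exact ENNReal.ofReal_le_ofReal (h3.diam_le hshape hT)

namespace IsRegularMesh

variable {N L K : ℝ≥0}

lemma self_mem_neighbors (h : IsRegularMesh Γ 𝒯 N L K) {T : Set (Eucl d)} (hT : T ∈ 𝒯) :
    T ∈ h.isMesh.neighbors T := by
  rw [h.isMesh.mem_neighbors, Set.inter_self]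
  refine ⟨hT, Set.nonempty_iff_ne_empty.2 ?_⟩
  rintro rfl
  simpa using h.diam_pos _ hT

lemma ofReal_diam_le (h : IsRegularMesh Γ 𝒯 N L K) {T T' : Set (Eucl d)} (hT : T ∈ 𝒯)
    (hT' : T' ∈ h.isMesh.neighbors T) :
    ENNReal.ofReal (Metric.diam T) ≤ L * ENNReal.ofReal (Metric.diam T') := by
  rw [← ENNReal.ofReal_coe_nnreal, ← ENNReal.ofReal_mul L.coe_nonneg]
  have := h.isMesh.mem_neighbors.1 hT'
  exact ENNReal.ofReal_le_ofReal (h.diam_le T hT T' this.1 this.2)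

lemma ofReal_diam_le' (h : IsRegularMesh Γ 𝒯 N L K) {T T' : Set (Eucl d)} (hT : T ∈ 𝒯)
    (hT' : T' ∈ h.isMesh.neighbors T) :
    ENNReal.ofReal (Metric.diam T') ≤ L * ENNReal.ofReal (Metric.diam T) :=
  have hT'' := (h.isMesh.mem_neighbors.1 hT').1
  h.ofReal_diam_le hT'' ((h.isMesh.mem_neighbors_comm hT hT'').1 hT')

lemma ofReal_diam_ne_zero (h : IsRegularMesh Γ 𝒯 N L K) {T : Set (Eucl d)} (hT : T ∈ 𝒯) :
    ENNReal.ofReal (Metric.diam T) ≠ 0 := by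
  simpa using h.diam_pos T hT

lemma measure_ne_top (h : IsRegularMesh Γ 𝒯 N L K) {T : Set (Eucl d)} (hT : T ∈ 𝒯) :
    surfaceMeasure Γ T ≠ ∞ :=
  ne_top_of_le_ne_top (by finiteness) (h.measure_le T hT)

lemma measure_ne_zero (h : IsRegularMesh Γ 𝒯 N L K) {T : Set (Eucl d)} (hT : T ∈ 𝒯) :
    surfaceMeasure Γ T ≠ 0 := by
  intro h0
  have := h.le_measure T hT
  rw [h0, mul_zero, nonpos_iff_eq_zero] at this
  exact pow_ne_zero _ (h.ofReal_diam_ne_zero hT) this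

lemma measure_neighbor_le (h : IsRegularMesh Γ 𝒯 N L K) {T T' : Set (Eucl d)} (hT : T ∈ 𝒯)
    (hT' : T' ∈ h.isMesh.neighbors T) :
    surfaceMeasure Γ T' ≤ K ^ 2 * L ^ (d - 1) * surfaceMeasure Γ T := by
  calc surfaceMeasure Γ T'
      ≤ K * ENNReal.ofReal (Metric.diam T') ^ (d - 1) :=
        h.measure_le T' (h.isMesh.mem_neighbors.1 hT').1
    _ ≤ K * (L * ENNReal.ofReal (Metric.diam T)) ^ (d - 1) := by
        gcongr; exact h.ofReal_diam_le' hT hT'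
    _ = K * L ^ (d - 1) * ENNReal.ofReal (Metric.diam T) ^ (d - 1) := by ring
    _ ≤ K * L ^ (d - 1) * (K * surfaceMeasure Γ T) := by gcongr; exact h.le_measure T hT
    _ = _ := by ring

lemma sum_neighbors_le (h : IsRegularMesh Γ 𝒯 N L K) {T : Set (Eucl d)} (hT : T ∈ 𝒯)
    (f : Set (Eucl d) → ℝ≥0∞) {b : ℝ≥0∞} (hf : ∀ T' ∈ h.isMesh.neighbors T, f T' ≤ b) :
    ∑ T' ∈ h.isMesh.neighbors T, f T' ≤ N * b := by
  refine (Finset.sum_le_card_nsmul _ _ _ hf).trans ?_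
  rw [nsmul_eq_mul]
  gcongr
  exact h.card_neighbors_le T hT

/-- Since the neighbour relation is symmetric, each `f T` occurs at most `N` times. -/
lemma sum_sum_neighbors_le (h : IsRegularMesh Γ 𝒯 N L K) (f : Set (Eucl d) → ℝ≥0∞) :
    ∑ T ∈ h.isMesh.elements, ∑ T' ∈ h.isMesh.neighbors T, f T' ≤
      N * ∑ T ∈ h.isMesh.elements, f T := by
  rw [Finset.sum_comm' (t' := h.isMesh.elements) (s' := fun T' => h.isMesh.neighbors T'),
    Finset.mul_sum]
  · refine Finset.sum_le_sum fun T hT => ?_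
    exact h.sum_neighbors_le (h.isMesh.mem_elements.1 hT) _ fun _ _ => le_rfl
  · intro T T'
    simp only [IsMesh.mem_elements, IsMesh.mem_neighbors]
    rw [Set.inter_comm]; tauto

lemma measure_patch_le (h : IsRegularMesh Γ 𝒯 N L K) (q : ℕ) {T : Set (Eucl d)} (hT : T ∈ 𝒯) :
    surfaceMeasure Γ (patch 𝒯 q T) ≤ (N * (K ^ 2 * L ^ (d - 1))) ^ q * surfaceMeasure Γ T := by
  induction q generalizing T with
  | zero => simp [patch]
  | succ q ih =>
    calc surfaceMeasure Γ (patch 𝒯 (q + 1) T)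
        ≤ ∑ T' ∈ h.isMesh.neighbors T, surfaceMeasure Γ (patch 𝒯 q T') :=
          (measure_mono (h.isMesh.patch_succ_subset q T)).trans (measure_biUnion_finset_le _ _)
      _ ≤ N * ((N * (K ^ 2 * L ^ (d - 1))) ^ q * (K ^ 2 * L ^ (d - 1) * surfaceMeasure Γ T)) := by
          refine h.sum_neighbors_le hT _ fun T' hT' => ?_
          refine (ih (h.isMesh.mem_neighbors.1 hT').1).trans ?_
          gcongr
          exact h.measure_neighbor_le hT hT'
      _ = _ := by ring

end IsRegularMesh

/-! ### Local estimates -/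


/-- The integral of `|v(x) - v(y)|² / |x - y|^d` over `A × B`. -/
def slobodeckijEnergy (μ : Measure (Eucl d)) (v : Eucl d → ℂ) (A B : Set (Eucl d)) : ℝ≥0∞ :=
  ∫⁻ x in A, ∫⁻ y in B, ‖v x - v y‖ₑ ^ 2 / edist x y ^ d ∂μ ∂μ

lemma slobodeckijSeminorm_sq (Γ ω : Set (Eucl d)) (v : L2 Γ) :
    slobodeckijSeminorm Γ (1 / 2) ω v ^ 2 = slobodeckijEnergy (surfaceMeasure Γ) v ω ω := by
  have hd : (d : ℝ) - 1 + 2 * (1 / 2) = d := by ring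
  rw [slobodeckijSeminorm, ← ENNReal.rpow_natCast, ← ENNReal.rpow_mul, slobodeckijEnergy, hd]
  simp

lemma slobodeckijEnergy_mono (μ : Measure (Eucl d)) (v : Eucl d → ℂ) {A A' B B' : Set (Eucl d)}
    (hA : A ⊆ A') (hB : B ⊆ B') : slobodeckijEnergy μ v A B ≤ slobodeckijEnergy μ v A' B' :=
  (lintegral_mono_set hA).trans (lintegral_mono fun _ => lintegral_mono_set hB)

/-- The local contribution `diam(T) ‖∇_Γ v‖²_{L²(T)}`, where `g = ∇_Γ v`. -/
def localGradient (Γ : Set (Eucl d)) (g : L2Field Γ) (T : Set (Eucl d)) : ℝ≥0∞ :=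
  ENNReal.ofReal (Metric.diam T) * ∫⁻ x in T, ‖g x‖ₑ ^ 2 ∂(surfaceMeasure Γ)

/-- The constant in the Poincaré inequality on the patches `π^q(T)`, see
`IsRegularMesh.sum_sqDifference_patch_le`. -/
def poincareConst (d : ℕ) (N L K C : ℝ≥0) : ℕ → ℝ≥0
  | 0 => 2 * (1 + L) ^ d * K * C ^ 2 * L ^ 2 * N
  | q + 1 => N * N * (2 * (N * (K ^ 2 * L ^ (d - 1))) ^ q *
      (2 * (1 + L) ^ d * K * C ^ 2 * L ^ 2)) + 2 * L * N * poincareConst d N L K C q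

namespace IsRegularMesh

variable {N L K : ℝ≥0}

lemma diam_patch_singleton_le (h : IsRegularMesh Γ 𝒯 N L K) {T : Set (Eucl d)} (hT : T ∈ 𝒯)
    {z : Eucl d} (hz : z ∈ T) : Metric.diam (patch 𝒯 1 {z}) ≤ 2 * L * Metric.diam T := by
  have hT0 := h.diam_pos T hT
  refine Metric.diam_le_of_forall_dist_le (by positivity) ?_
  have hdist : ∀ x ∈ patch 𝒯 1 {z}, dist x z ≤ L * Metric.diam T := by
    rintro x ⟨T', ⟨hT', y, hy, rfl⟩, hx⟩
    exact (Metric.dist_le_diam_of_mem (h.isMesh.isCompact hT').isBounded hx hy).trans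
      (h.diam_le T' hT' T hT ⟨y, hy, hz⟩)
  intro x hx y hy
  linarith [hdist x hx, hdist y hy, dist_triangle_right x y z]

/-- The energy of a pair of neighbours is bounded by the energy on a node patch. -/
lemma slobodeckijEnergy_neighbor_le (h : IsRegularMesh Γ 𝒯 N L K) {C : ℝ≥0}
    (hC : LocalSeminormEstimate Γ 𝒯 C) {v : L2 Γ} {g : L2Field Γ}
    (hg : HasSurfaceGradient Γ v g) {T T' : Set (Eucl d)} (hT : T ∈ 𝒯)
    (hT' : T' ∈ h.isMesh.neighbors T) :
    slobodeckijEnergy (surfaceMeasure Γ) v T T' ≤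
      2 * C ^ 2 * L ^ 2 * ∑ T'' ∈ h.isMesh.neighbors T, localGradient Γ g T'' := by
  obtain ⟨hT'm, z, hzT, hzT'⟩ := h.isMesh.mem_neighbors.1 hT'
  have hM5 := hC v g hg z (h.isMesh.subset hT hzT)
  calc slobodeckijEnergy (surfaceMeasure Γ) v T T'
      ≤ slobodeckijEnergy (surfaceMeasure Γ) v (patch 𝒯 1 {z}) (patch 𝒯 1 {z}) :=
        slobodeckijEnergy_mono _ _ (subset_patch_singleton hT hzT)
          (subset_patch_singleton hT'm hzT')
    _ = slobodeckijSeminorm Γ (1 / 2) (patch 𝒯 1 {z}) v ^ 2 := (slobodeckijSeminorm_sq _ _ _).symm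
    _ ≤ (ENNReal.ofReal (C * √(Metric.diam (patch 𝒯 1 {z}))) *
          eLpNorm g 2 ((surfaceMeasure Γ).restrict (patch 𝒯 1 {z}))) ^ 2 := by gcongr
    _ = C ^ 2 * ENNReal.ofReal (Metric.diam (patch 𝒯 1 {z})) *
          ∫⁻ x in patch 𝒯 1 {z}, ‖g x‖ₑ ^ 2 ∂(surfaceMeasure Γ) := by
        rw [mul_pow, eLpNorm_two_sq, ENNReal.ofReal_mul C.coe_nonneg, mul_pow,
          ENNReal.ofReal_coe_nnreal, ← ENNReal.ofReal_pow (Real.sqrt_nonneg _),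
          Real.sq_sqrt Metric.diam_nonneg]
    _ ≤ C ^ 2 * (2 * L * ENNReal.ofReal (Metric.diam T)) *
          ∑ T'' ∈ h.isMesh.neighbors T, ∫⁻ x in T'', ‖g x‖ₑ ^ 2 ∂(surfaceMeasure Γ) := by
        gcongr
        · refine (ENNReal.ofReal_le_ofReal (h.diam_patch_singleton_le hT hzT)).trans_eq ?_
          rw [ENNReal.ofReal_mul (by positivity), ENNReal.ofReal_mul zero_le_two,
            ENNReal.ofReal_coe_nnreal, ENNReal.ofReal_ofNat]
        · exact (lintegral_mono_set (h.isMesh.patch_singleton_subset hzT)).trans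
            (setLIntegral_biUnion_finset_le _ _ _ _)
    _ = 2 * C ^ 2 * L * ∑ T'' ∈ h.isMesh.neighbors T, ENNReal.ofReal (Metric.diam T) *
          ∫⁻ x in T'', ‖g x‖ₑ ^ 2 ∂(surfaceMeasure Γ) := by
        rw [← Finset.mul_sum]; ring
    _ ≤ 2 * C ^ 2 * L * ∑ T'' ∈ h.isMesh.neighbors T, L * localGradient Γ g T'' := by
        refine mul_le_mul_right (Finset.sum_le_sum fun T'' hT'' => ?_) _
        rw [localGradient, ← mul_assoc]
        refine mul_le_mul_left ?_ _
        exact h.ofReal_diam_le hT hT''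
    _ = _ := by rw [← Finset.mul_sum]; ring

/-- Neighbours have a common point, so that points of `T` and `T'` have a distance of at most
`diam(T) + diam(T')`. -/
lemma sqDifference_neighbor_le_slobodeckijEnergy (h : IsRegularMesh Γ 𝒯 N L K)
    (μ : Measure (Eucl d)) {v : Eucl d → ℂ} (hv : Measurable v) {T T' : Set (Eucl d)} (hT : T ∈ 𝒯)
    (hT' : T' ∈ h.isMesh.neighbors T) :
    sqDifference μ v T T' ≤
      ((1 + L) * ENNReal.ofReal (Metric.diam T)) ^ d * slobodeckijEnergy μ v T T' := by
  obtain ⟨hT'm, z, hzT, hzT'⟩ := h.isMesh.mem_neighbors.1 hT'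
  have hpt : ∀ x ∈ T, ∀ y ∈ T', ‖v x - v y‖ₑ ^ 2 ≤
      ((1 + L) * ENNReal.ofReal (Metric.diam T)) ^ d * (‖v x - v y‖ₑ ^ 2 / edist x y ^ d) := by
    intro x hx y hy
    rcases eq_or_ne x y with rfl | hxy
    · simp
    have hdist : edist x y ≤ (1 + L) * ENNReal.ofReal (Metric.diam T) := by
      calc edist x y ≤ edist x z + edist z y := edist_triangle _ _ _
        _ ≤ ENNReal.ofReal (Metric.diam T) + ENNReal.ofReal (Metric.diam T') := by
            rw [edist_dist, edist_dist]
            gcongr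
            · exact Metric.dist_le_diam_of_mem (h.isMesh.isCompact hT).isBounded hx hzT
            · exact Metric.dist_le_diam_of_mem (h.isMesh.isCompact hT'm).isBounded hzT' hy
        _ ≤ ENNReal.ofReal (Metric.diam T) + L * ENNReal.ofReal (Metric.diam T) := by
            gcongr; exact h.ofReal_diam_le' hT hT'
        _ = _ := by ring
    have h0 : edist x y ^ d ≠ 0 := pow_ne_zero _ (by simpa using hxy)
    have htop : edist x y ^ d ≠ ∞ := ENNReal.pow_ne_top (edist_ne_top _ _)
    calc ‖v x - v y‖ₑ ^ 2 = edist x y ^ d * (‖v x - v y‖ₑ ^ 2 / edist x y ^ d) :=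
          (ENNReal.mul_div_cancel h0 htop).symm
      _ ≤ _ := by gcongr
  have hm : Measurable fun p : Eucl d × Eucl d => ‖v p.1 - v p.2‖ₑ ^ 2 / edist p.1 p.2 ^ d := by
    fun_prop
  have htop : ((1 + L) * ENNReal.ofReal (Metric.diam T)) ^ d ≠ ∞ := by finiteness
  unfold sqDifference slobodeckijEnergy
  rw [← lintegral_const_mul' _ _ htop]
  refine setLIntegral_mono' (h.isMesh.measurableSet hT) fun x hx => ?_
  rw [← lintegral_const_mul' _ _ htop]
  exact setLIntegral_mono' (h.isMesh.measurableSet hT'm) fun y hy => hpt x hx y hy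

/-- A Poincaré inequality, in terms of mean square differences, for a pair of neighbours. -/
lemma sqDifference_neighbor_le (hd : 2 ≤ d) (h : IsRegularMesh Γ 𝒯 N L K) {C : ℝ≥0}
    (hC : LocalSeminormEstimate Γ 𝒯 C) {v : L2 Γ} {g : L2Field Γ}
    (hg : HasSurfaceGradient Γ v g) {T T' : Set (Eucl d)} (hT : T ∈ 𝒯)
    (hT' : T' ∈ h.isMesh.neighbors T) :
    sqDifference (surfaceMeasure Γ) v T T' ≤
      2 * (1 + L) ^ d * K * C ^ 2 * L ^ 2 * (ENNReal.ofReal (Metric.diam T) * surfaceMeasure Γ T) *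
        ∑ T'' ∈ h.isMesh.neighbors T, localGradient Γ g T'' := by
  have hdiam : ENNReal.ofReal (Metric.diam T) ^ d ≤
      K * surfaceMeasure Γ T * ENNReal.ofReal (Metric.diam T) := by
    rw [← pow_sub_one_mul (by omega : d ≠ 0)]
    gcongr
    exact h.le_measure T hT
  calc sqDifference (surfaceMeasure Γ) v T T'
      ≤ ((1 + L) * ENNReal.ofReal (Metric.diam T)) ^ d *
          slobodeckijEnergy (surfaceMeasure Γ) v T T' :=
        h.sqDifference_neighbor_le_slobodeckijEnergy _ (Lp.stronglyMeasurable v).measurable hT hT'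
    _ ≤ (1 + L) ^ d * (K * surfaceMeasure Γ T * ENNReal.ofReal (Metric.diam T)) *
          (2 * C ^ 2 * L ^ 2 * ∑ T'' ∈ h.isMesh.neighbors T, localGradient Γ g T'') := by
        rw [mul_pow]
        gcongr
        exact h.slobodeckijEnergy_neighbor_le hC hg hT hT'
    _ = _ := by ring

/-! ### Poincaré inequality on patches of higher order -/

/-- The Poincaré inequality on the patches `π^q(T)`, summed over all elements. The induction on `q`
compares the values of `v` on `T` and on `π^q(T')`, for a neighbour `T'` of `T`, through the
values on `T'`. -/
lemma sum_sqDifference_patch_le (hd : 2 ≤ d) (h : IsRegularMesh Γ 𝒯 N L K)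
    [SFinite (surfaceMeasure Γ)] {C : ℝ≥0}
    (hC : LocalSeminormEstimate Γ 𝒯 C) {v : L2 Γ} {g : L2Field Γ}
    (hg : HasSurfaceGradient Γ v g) (q : ℕ) :
    ∑ T ∈ h.isMesh.elements, (ENNReal.ofReal (Metric.diam T) * surfaceMeasure Γ T)⁻¹ *
        sqDifference (surfaceMeasure Γ) v T (patch 𝒯 q T) ≤
      poincareConst d N L K C q * ∑ T ∈ h.isMesh.elements, localGradient Γ g T := by
  set μ := surfaceMeasure Γ with hμ
  set c : ℝ≥0∞ := 2 * (1 + L) ^ d * K * C ^ 2 * L ^ 2 with hc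
  set E := localGradient Γ g with hE
  have hv : Measurable v := (Lp.stronglyMeasurable v).measurable
  -- the Poincaré inequality for neighbours, in normalized form
  have hnb : ∀ T ∈ 𝒯, ∀ T' ∈ h.isMesh.neighbors T,
      (ENNReal.ofReal (Metric.diam T) * μ T)⁻¹ * sqDifference μ v T T' ≤
        c * ∑ T'' ∈ h.isMesh.neighbors T, E T'' := by
    intro T hT T' hT'
    have h0 : ENNReal.ofReal (Metric.diam T) * μ T ≠ 0 :=
      mul_ne_zero (h.ofReal_diam_ne_zero hT) (h.measure_ne_zero hT)
    have htop : ENNReal.ofReal (Metric.diam T) * μ T ≠ ∞ :=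
      ENNReal.mul_ne_top ENNReal.ofReal_ne_top (h.measure_ne_top hT)
    calc _ ≤ (ENNReal.ofReal (Metric.diam T) * μ T)⁻¹ *
          (c * (ENNReal.ofReal (Metric.diam T) * μ T) *
            ∑ T'' ∈ h.isMesh.neighbors T, E T'') := by
          gcongr; exact h.sqDifference_neighbor_le hd hC hg hT hT'
      _ = ((ENNReal.ofReal (Metric.diam T) * μ T)⁻¹ * (ENNReal.ofReal (Metric.diam T) * μ T)) *
            (c * ∑ T'' ∈ h.isMesh.neighbors T, E T'') := by ring
      _ = _ := by rw [ENNReal.inv_mul_cancel h0 htop, one_mul]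
  induction q with
  | zero =>
    calc _ ≤ ∑ T ∈ h.isMesh.elements, c * ∑ T'' ∈ h.isMesh.neighbors T, E T'' := by
          refine Finset.sum_le_sum fun T hT => ?_
          have hT := h.isMesh.mem_elements.1 hT
          exact hnb T hT T (h.self_mem_neighbors hT)
      _ ≤ c * (N * ∑ T ∈ h.isMesh.elements, E T) := by
          rw [← Finset.mul_sum]; gcongr; exact h.sum_sum_neighbors_le _
      _ = _ := by rw [poincareConst, hc]; push_cast; ring
  | succ q ih =>
    set R : ℝ≥0∞ := (N * (K ^ 2 * L ^ (d - 1))) ^ q with hR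
    -- pass from `T` to `π^q(T')` through the neighbour `T'`
    set Z : Set (Eucl d) → ℝ≥0∞ := fun T => (ENNReal.ofReal (Metric.diam T) * μ T)⁻¹ *
        sqDifference μ v T (patch 𝒯 q T) with hZ
    have hstep : ∀ T ∈ 𝒯, ∀ T' ∈ h.isMesh.neighbors T,
        (ENNReal.ofReal (Metric.diam T) * μ T)⁻¹ * sqDifference μ v T (patch 𝒯 q T') ≤
          2 * R * (c * ∑ T'' ∈ h.isMesh.neighbors T, E T'') + 2 * L * Z T' := by
      intro T hT T' hT'
      have hT'm := (h.isMesh.mem_neighbors.1 hT').1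
      set s := ENNReal.ofReal (Metric.diam T) with hs
      set s' := ENNReal.ofReal (Metric.diam T') with hs'
      have hs0 : s ≠ 0 := h.ofReal_diam_ne_zero hT
      have hs'0 : s' ≠ 0 := h.ofReal_diam_ne_zero hT'm
      have hsfin : s ≠ ∞ := ENNReal.ofReal_ne_top
      have hs'fin : s' ≠ ∞ := ENNReal.ofReal_ne_top
      have hm0 : μ T ≠ 0 := h.measure_ne_zero hT
      have hm'0 : μ T' ≠ 0 := h.measure_ne_zero hT'm
      have hmfin : μ T ≠ ∞ := h.measure_ne_top hT
      have hm'fin : μ T' ≠ ∞ := h.measure_ne_top hT'm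
      have htri := measure_mul_sqDifference_le μ hv T T' (patch 𝒯 q T')
      have hs_inv : s⁻¹ ≤ L * s'⁻¹ := by
        calc s⁻¹ = s⁻¹ * s' * s'⁻¹ := by
              rw [mul_assoc, ENNReal.mul_inv_cancel hs'0 hs'fin, mul_one]
          _ ≤ s⁻¹ * (L * s) * s'⁻¹ := by gcongr; exact h.ofReal_diam_le' hT hT'
          _ = (s⁻¹ * s) * (L * s'⁻¹) := by ring
          _ = L * s'⁻¹ := by rw [ENNReal.inv_mul_cancel hs0 hsfin, one_mul]
      have hdiv : sqDifference μ v T (patch 𝒯 q T') ≤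
          2 * R * sqDifference μ v T T' +
            2 * μ T * ((μ T')⁻¹ * sqDifference μ v T' (patch 𝒯 q T')) := by
        calc sqDifference μ v T (patch 𝒯 q T')
            = (μ T')⁻¹ * (μ T' * sqDifference μ v T (patch 𝒯 q T')) := by
              rw [← mul_assoc, ENNReal.inv_mul_cancel hm'0 hm'fin, one_mul]
          _ ≤ (μ T')⁻¹ * (2 * (R * μ T') * sqDifference μ v T T' +
                2 * μ T * sqDifference μ v T' (patch 𝒯 q T')) := by
              gcongr
              refine htri.trans ?_
              gcongr
              exact h.measure_patch_le q hT'm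
          _ = ((μ T')⁻¹ * μ T') * (2 * R * sqDifference μ v T T') +
                2 * μ T * ((μ T')⁻¹ * sqDifference μ v T' (patch 𝒯 q T')) := by ring
          _ = _ := by rw [ENNReal.inv_mul_cancel hm'0 hm'fin, one_mul]
      calc (s * μ T)⁻¹ * sqDifference μ v T (patch 𝒯 q T')
          ≤ (s * μ T)⁻¹ * (2 * R * sqDifference μ v T T' +
            2 * μ T * ((μ T')⁻¹ * sqDifference μ v T' (patch 𝒯 q T'))) := by gcongr
        _ = 2 * R * ((s * μ T)⁻¹ * sqDifference μ v T T') +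
            2 * (s⁻¹ * ((μ T)⁻¹ * μ T)) * ((μ T')⁻¹ * sqDifference μ v T' (patch 𝒯 q T')) := by
            rw [ENNReal.mul_inv (.inl hs0) (.inl hsfin)]; ring
        _ ≤ 2 * R * (c * ∑ T'' ∈ h.isMesh.neighbors T, E T'') +
            2 * (L * s'⁻¹) * ((μ T')⁻¹ * sqDifference μ v T' (patch 𝒯 q T')) := by
            rw [ENNReal.inv_mul_cancel hm0 hmfin, mul_one]
            gcongr 2 * R * ?_ + 2 * ?_ * _
            exact hnb T hT T' hT'
        _ = _ := by
            simp only [hZ]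
            rw [ENNReal.mul_inv (.inl hs'0) (.inl hs'fin)]; ring
    calc ∑ T ∈ h.isMesh.elements, (ENNReal.ofReal (Metric.diam T) * μ T)⁻¹ *
          sqDifference μ v T (patch 𝒯 (q + 1) T)
        ≤ ∑ T ∈ h.isMesh.elements, ∑ T' ∈ h.isMesh.neighbors T,
            (2 * R * (c * ∑ T'' ∈ h.isMesh.neighbors T, E T'') + 2 * L * Z T') := by
          refine Finset.sum_le_sum fun T hT => ?_
          have hT := h.isMesh.mem_elements.1 hT
          calc _ ≤ (ENNReal.ofReal (Metric.diam T) * μ T)⁻¹ *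
                ∑ T' ∈ h.isMesh.neighbors T, sqDifference μ v T (patch 𝒯 q T') := by
                gcongr
                rw [sqDifference_comm μ hv]
                simp_rw [sqDifference_comm μ hv T]
                exact (lintegral_mono_set (h.isMesh.patch_succ_subset q T)).trans
                  (setLIntegral_biUnion_finset_le _ _ _ _)
            _ ≤ _ := by
                rw [Finset.mul_sum]
                exact Finset.sum_le_sum fun T' hT' => hstep T hT T' hT'
      _ ≤ ∑ T ∈ h.isMesh.elements, (N * (2 * R * (c * ∑ T'' ∈ h.isMesh.neighbors T, E T'')) +
            ∑ T' ∈ h.isMesh.neighbors T, 2 * L * Z T') := by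
          refine Finset.sum_le_sum fun T hT => ?_
          rw [Finset.sum_add_distrib]
          gcongr
          exact h.sum_neighbors_le (h.isMesh.mem_elements.1 hT) _ fun _ _ => le_rfl
      _ = N * (2 * R * (c * ∑ T ∈ h.isMesh.elements, ∑ T'' ∈ h.isMesh.neighbors T, E T'')) +
            2 * L * ∑ T ∈ h.isMesh.elements, ∑ T' ∈ h.isMesh.neighbors T, Z T' := by
          simp_rw [Finset.sum_add_distrib, ← Finset.mul_sum]
      _ ≤ N * (2 * R * (c * (N * ∑ T ∈ h.isMesh.elements, E T))) +
            2 * L * (N * (poincareConst d N L K C q * ∑ T ∈ h.isMesh.elements, E T)) := by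
          gcongr
          · exact h.sum_sum_neighbors_le _
          · exact (h.sum_sum_neighbors_le _).trans (by gcongr)
      _ = _ := by rw [poincareConst, hc, hR]; push_cast; ring

end IsRegularMesh

/-! ### Localization of the Slobodeckij seminorm -/

lemma CenteredInPatches.le_dist {C : ℝ} (hC : 0 < C) (h : CenteredInPatches Γ 𝒯 C)
    {T : Set (Eucl d)} (hT : T ∈ 𝒯) {x y : Eucl d} (hx : x ∈ T) (hy : y ∈ Γ \ patch 𝒯 1 T) :
    Metric.diam T / C ≤ dist x y := by
  rw [div_le_iff₀' hC]
  refine (h T hT).trans ?_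
  rw [patchDist, if_pos ⟨y, hy⟩]
  gcongr
  refine csInf_le ⟨0, ?_⟩ ⟨x, hx, y, hy, rfl⟩
  rintro _ ⟨a, -, b, -, rfl⟩
  exact dist_nonneg

/-- The interaction of an element with the elements that it does not touch. Up to a null set, the
latter lie outside the patch of the element, at a distance of at least `diam(T) / C`. -/
lemma IsRegularMesh.sum_far_le (hd : 2 ≤ d) {N L K : ℝ≥0} (h : IsRegularMesh Γ 𝒯 N L K) {C : ℝ}
    (hC : 0 < C) (hcent : CenteredInPatches Γ 𝒯 C) {A : ℝ≥0}
    (hA : ∀ (x : Eucl d) (r : ℝ), 0 ≤ r →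
      surfaceMeasure Γ (Metric.closedBall x r) ≤ A * ENNReal.ofReal r ^ (d - 1))
    [SFinite (surfaceMeasure Γ)] [DecidableEq (Set (Eucl d))]
    {v : Eucl d → ℂ} (hv : Measurable v) {T : Set (Eucl d)} (hT : T ∈ 𝒯) :
    ∑ T' ∈ h.isMesh.elements \ h.isMesh.neighbors T,
        ∫⁻ x in T, ∫⁻ y in T', ‖v x‖ₑ ^ 2 * (edist x y ^ d)⁻¹
          ∂(surfaceMeasure Γ) ∂(surfaceMeasure Γ) ≤
      A * 2 ^ d * ENNReal.ofReal C *
        ((ENNReal.ofReal (Metric.diam T))⁻¹ * ∫⁻ x in T, ‖v x‖ₑ ^ 2 ∂(surfaceMeasure Γ)) := by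
  set μ := surfaceMeasure Γ with hμ
  have hm : Measurable fun p : Eucl d × Eucl d => ‖v p.1‖ₑ ^ 2 * (edist p.1 p.2 ^ d)⁻¹ := by
    fun_prop
  have hδ : 0 < Metric.diam T / C := div_pos (h.diam_pos T hT) hC
  have hpt : ∀ x ∈ T, ∑ T' ∈ h.isMesh.elements \ h.isMesh.neighbors T,
      ∫⁻ y in T', ‖v x‖ₑ ^ 2 * (edist x y ^ d)⁻¹ ∂μ ≤
        ‖v x‖ₑ ^ 2 * (A * 2 ^ d * (ENNReal.ofReal C * (ENNReal.ofReal (Metric.diam T))⁻¹)) := by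
    intro x hx
    have htail := lintegral_inv_edist_pow_le hA x hδ
    rw [Nat.sub_add_cancel (by omega : 1 ≤ d)] at htail
    have hinv : (ENNReal.ofReal (Metric.diam T / C))⁻¹ =
        ENNReal.ofReal C * (ENNReal.ofReal (Metric.diam T))⁻¹ := by
      rw [ENNReal.ofReal_div_of_pos hC, ENNReal.inv_div (.inl ENNReal.ofReal_ne_top)
        (.inl (by simpa using hC)), div_eq_mul_inv]
    rw [hinv] at htail
    have hnull : ∀ T' ∈ h.isMesh.elements \ h.isMesh.neighbors T,
        ∀ᵐ y ∂μ, y ∈ T' → y ∉ patch 𝒯 1 T := by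
      intro T' hT'
      obtain ⟨hT'm, hT'n⟩ := Finset.mem_sdiff.1 hT'
      rw [h.isMesh.patch_one_eq]
      have : ∀ T'' ∈ h.isMesh.neighbors T, ∀ᵐ y ∂μ, ¬ (y ∈ T' ∧ y ∈ T'') := by
        intro T'' hT''
        have hne : T' ≠ T'' := by rintro rfl; exact hT'n hT''
        exact measure_eq_zero_iff_ae_notMem.1 (h.isMesh.overlap T'
          (h.isMesh.mem_elements.1 hT'm) T'' (h.isMesh.mem_neighbors.1 hT'').1 hne)
      filter_upwards [(Finset.eventually_all _).2 this] with y hy hyT' hyU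
      obtain ⟨T'', hT'', hyT''⟩ := Set.mem_iUnion₂.1 hyU
      exact hy T'' hT'' ⟨hyT', hyT''⟩
    have hsub : (⋃ T' ∈ h.isMesh.elements \ h.isMesh.neighbors T, T' : Set (Eucl d)) ≤ᵐ[μ]
        {y | Metric.diam T / C ≤ dist x y} := by
      filter_upwards [(Finset.eventually_all _).2 hnull] with y hy hyU
      obtain ⟨T', hT', hyT'⟩ := Set.mem_iUnion₂.1 hyU
      exact hcent.le_dist hC hT hx ⟨h.isMesh.subset
        (h.isMesh.mem_elements.1 (Finset.mem_sdiff.1 hT').1) hyT', hy T' hT' hyT'⟩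
    have hmx : Measurable fun y => (edist x y ^ d)⁻¹ := by fun_prop
    simp_rw [lintegral_const_mul _ hmx]
    rw [← Finset.mul_sum, h.isMesh.sum_setLIntegral_eq Finset.sdiff_subset]
    gcongr
    exact (lintegral_mono_set' hsub).trans htail
  have hmT' : ∀ T' ∈ h.isMesh.elements \ h.isMesh.neighbors T,
      Measurable fun x => ∫⁻ y in T', ‖v x‖ₑ ^ 2 * (edist x y ^ d)⁻¹ ∂μ :=
    fun T' _ => hm.lintegral_prod_right'
  rw [← lintegral_finsetSum _ hmT']
  refine (setLIntegral_mono' (h.isMesh.measurableSet hT) hpt).trans_eq ?_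
  rw [lintegral_mul_const _ (by fun_prop)]
  ring

/-- Localization of the Slobodeckij seminorm: interactions of elements that do not touch are
controlled by a weighted `L²`-norm. -/
lemma IsRegularMesh.slobodeckijEnergy_le (hd : 2 ≤ d) {N L K : ℝ≥0}
    (h : IsRegularMesh Γ 𝒯 N L K) {C : ℝ}
    (hC : 0 < C) (hcent : CenteredInPatches Γ 𝒯 C) {A : ℝ≥0}
    (hA : ∀ (x : Eucl d) (r : ℝ), 0 ≤ r →
      surfaceMeasure Γ (Metric.closedBall x r) ≤ A * ENNReal.ofReal r ^ (d - 1))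
    [SFinite (surfaceMeasure Γ)] {v : Eucl d → ℂ} (hv : Measurable v) :
    slobodeckijEnergy (surfaceMeasure Γ) v Γ Γ ≤
      ∑ T ∈ h.isMesh.elements, ∑ T' ∈ h.isMesh.neighbors T,
          slobodeckijEnergy (surfaceMeasure Γ) v T T' +
        4 * (A * 2 ^ d * ENNReal.ofReal C) * ∑ T ∈ h.isMesh.elements,
          (ENNReal.ofReal (Metric.diam T))⁻¹ * ∫⁻ x in T, ‖v x‖ₑ ^ 2 ∂(surfaceMeasure Γ) := by
  classical
  set μ := surfaceMeasure Γ with hμ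
  set G : Set (Eucl d) → Set (Eucl d) → ℝ≥0∞ := fun T T' =>
    ∫⁻ x in T, ∫⁻ y in T', ‖v x‖ₑ ^ 2 * (edist x y ^ d)⁻¹ ∂μ ∂μ with hG
  have hm : Measurable fun p : Eucl d × Eucl d => ‖v p.1‖ₑ ^ 2 * (edist p.1 p.2 ^ d)⁻¹ := by
    fun_prop
  have hm' : Measurable fun p : Eucl d × Eucl d => ‖v p.2‖ₑ ^ 2 * (edist p.1 p.2 ^ d)⁻¹ := by
    fun_prop
  have hcover : slobodeckijEnergy μ v Γ Γ ≤ ∑ T ∈ h.isMesh.elements, ∑ T' ∈ h.isMesh.elements,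
      slobodeckijEnergy μ v T T' := by
    unfold slobodeckijEnergy
    conv_lhs => rw [← h.isMesh.biUnion_elements]
    have hmk : Measurable fun p : Eucl d × Eucl d =>
        ‖v p.1 - v p.2‖ₑ ^ 2 / edist p.1 p.2 ^ d := by fun_prop
    refine (setLIntegral_biUnion_finset_le _ _ _ _).trans (Finset.sum_le_sum fun T _ => ?_)
    rw [← lintegral_finsetSum _ fun T' _ => hmk.lintegral_prod_right']
    exact lintegral_mono fun x => setLIntegral_biUnion_finset_le _ _ _ _
  have hfar : ∀ T T', slobodeckijEnergy μ v T T' ≤ 2 * G T T' + 2 * G T' T := by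
    intro T T'
    have hsymm : G T' T = ∫⁻ x in T, ∫⁻ y in T', ‖v y‖ₑ ^ 2 * (edist x y ^ d)⁻¹ ∂μ ∂μ := by
      simp only [hG]
      rw [lintegral_lintegral_swap hm.aemeasurable]
      simp_rw [edist_comm]
    rw [hsymm]
    simp only [hG]
    rw [← lintegral_const_mul _ hm.lintegral_prod_right',
      ← lintegral_const_mul _ hm'.lintegral_prod_right',
      ← lintegral_add_left (hm.lintegral_prod_right'.const_mul 2)]
    refine lintegral_mono fun x => ?_
    rw [← lintegral_const_mul _ (by fun_prop), ← lintegral_const_mul _ (by fun_prop),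
      ← lintegral_add_left (by fun_prop)]
    refine lintegral_mono fun y => ?_
    have := enorm_sub_sq_le (v x) 0 (v y)
    rw [sub_zero, sub_zero] at this
    calc ‖v x - v y‖ₑ ^ 2 / edist x y ^ d = ‖v x - v y‖ₑ ^ 2 * (edist x y ^ d)⁻¹ := rfl
      _ ≤ (2 * ‖v x‖ₑ ^ 2 + 2 * ‖v y‖ₑ ^ 2) * (edist x y ^ d)⁻¹ := by gcongr
      _ = _ := by ring
  -- not touching is a symmetric relation
  have hswap : ∑ T ∈ h.isMesh.elements, ∑ T' ∈ h.isMesh.elements \ h.isMesh.neighbors T, G T' T =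
      ∑ T ∈ h.isMesh.elements, ∑ T' ∈ h.isMesh.elements \ h.isMesh.neighbors T, G T T' := by
    refine Finset.sum_comm' fun T T' => ?_
    simp only [Finset.mem_sdiff, IsMesh.mem_elements, IsMesh.mem_neighbors]
    rw [Set.inter_comm]; tauto
  have hsplit : ∀ T ∈ h.isMesh.elements, ∑ T' ∈ h.isMesh.elements, slobodeckijEnergy μ v T T' =
      ∑ T' ∈ h.isMesh.elements \ h.isMesh.neighbors T, slobodeckijEnergy μ v T T' +
        ∑ T' ∈ h.isMesh.neighbors T, slobodeckijEnergy μ v T T' := fun T _ =>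
    (Finset.sum_sdiff fun T' hT' =>
      h.isMesh.mem_elements.2 (h.isMesh.mem_neighbors.1 hT').1).symm
  refine hcover.trans ?_
  rw [Finset.sum_congr rfl hsplit, Finset.sum_add_distrib, add_comm]
  gcongr
  calc ∑ T ∈ h.isMesh.elements, ∑ T' ∈ h.isMesh.elements \ h.isMesh.neighbors T,
        slobodeckijEnergy μ v T T'
      ≤ ∑ T ∈ h.isMesh.elements, ∑ T' ∈ h.isMesh.elements \ h.isMesh.neighbors T,
        (2 * G T T' + 2 * G T' T) :=
        Finset.sum_le_sum fun T _ => Finset.sum_le_sum fun T' _ => hfar T T'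
    _ = 4 * ∑ T ∈ h.isMesh.elements, ∑ T' ∈ h.isMesh.elements \ h.isMesh.neighbors T,
        G T T' := by
        simp_rw [Finset.sum_add_distrib, ← Finset.mul_sum]
        rw [hswap]; ring
    _ ≤ 4 * ∑ T ∈ h.isMesh.elements, A * 2 ^ d * ENNReal.ofReal C *
        ((ENNReal.ofReal (Metric.diam T))⁻¹ * ∫⁻ x in T, ‖v x‖ₑ ^ 2 ∂μ) := by
        gcongr with T hT
        exact h.sum_far_le hd hC hcent hA hv (h.isMesh.mem_elements.1 hT)
    _ = _ := by rw [← Finset.mul_sum]; ring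

/-! ### Orthogonality to the approximation of unity -/

/-- The complement of the support is a union of open sets on which `ψ` vanishes almost everywhere;
countably many of them suffice. -/
lemma ae_eq_zero_of_notMem_essSupport (ψ : L2 Γ) :
    ∀ᵐ x ∂(surfaceMeasure Γ), x ∉ essSupport ψ → ψ x = 0 := by
  have hm : MeasurableSet {x | ψ x ≠ 0} :=
    (Lp.stronglyMeasurable ψ).measurable (measurableSet_singleton 0).compl
  suffices surfaceMeasure Γ ({x | ψ x ≠ 0} \ essSupport ψ) = 0 by
    filter_upwards [measure_eq_zero_iff_ae_notMem.1 this] with x hx hxS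
    by_contra h0
    exact hx ⟨h0, hxS⟩
  refine measure_null_of_locally_null _ fun x hx => ?_
  have hxS := hx.2
  simp only [essSupport, Set.mem_ofPred_eq, not_forall, not_not] at hxS
  obtain ⟨O, hO, hψ⟩ := hxS
  refine ⟨({x | ψ x ≠ 0} \ essSupport ψ) ∩ O,
    Filter.inter_mem self_mem_nhdsWithin (nhdsWithin_le_nhds hO), ?_⟩
  have h0 : (surfaceMeasure Γ).restrict O {x | ψ x ≠ 0} = 0 := ae_iff.1 hψ
  rw [Measure.restrict_apply hm] at h0
  exact measure_mono_null (Set.inter_subset_inter_left _ Set.sdiff_subset) h0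

lemma essSupport_zero : essSupport (0 : L2 Γ) = ∅ := by
  refine Set.eq_empty_of_forall_notMem fun x hx => hx Set.univ Filter.univ_mem ?_
  rw [Measure.restrict_univ]
  exact Lp.coeFn_zero _ _ _

lemma vecSupport_eq {D : ℕ} {ψ : Fin D → L2 Γ} {j : Fin D} (hψ : ∀ j' ≠ j, ψ j' = 0) :
    vecSupport ψ = essSupport (ψ j) := by
  refine Set.Subset.antisymm (Set.iUnion_subset fun j' => ?_) 
    (Set.subset_iUnion (fun j => essSupport (ψ j)) j)
  rcases eq_or_ne j' j with rfl | hne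
  · rfl
  · rw [hψ j' hne, essSupport_zero]
    exact Set.empty_subset _

/-- A weighted Poincaré inequality for functions orthogonal to a local approximation of unity. -/
lemma IsRegularMesh.sum_inv_diam_mul_le (hd : 2 ≤ d) {N L K : ℝ≥0} (h : IsRegularMesh Γ 𝒯 N L K)
    [SFinite (surfaceMeasure Γ)] {C : ℝ≥0} (hC : LocalSeminormEstimate Γ 𝒯 C) {v : L2 Γ}
    {g : L2Field Γ} (hg : HasSurfaceGradient Γ v g) {q : ℕ} {ρ : ℝ} (hρ0 : 0 ≤ ρ) (hρ1 : ρ < 1)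
    {ψ : Set (Eucl d) → L2 Γ} (hsupp : ∀ T ∈ 𝒯, T ⊆ essSupport (ψ T))
    (hpatch : ∀ T ∈ 𝒯, essSupport (ψ T) ⊆ patch 𝒯 q T)
    (happrox : ∀ T ∈ 𝒯,
      eLpNorm (fun x => 1 - ψ T x) 2 ((surfaceMeasure Γ).restrict (essSupport (ψ T))) ≤
        ENNReal.ofReal ρ * (surfaceMeasure Γ (essSupport (ψ T))) ^ (1 / 2 : ℝ))
    (horth : ∀ T ∈ 𝒯, inner ℂ v (ψ T) = 0) :
    ∑ T ∈ h.isMesh.elements,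
        (ENNReal.ofReal (Metric.diam T))⁻¹ * ∫⁻ x in T, ‖v x‖ₑ ^ 2 ∂(surfaceMeasure Γ) ≤
      (ENNReal.ofReal (1 + ρ) / ENNReal.ofReal (1 - ρ)) ^ 2 * poincareConst d N L K C q *
        ∑ T ∈ h.isMesh.elements, localGradient Γ g T := by
  set μ := surfaceMeasure Γ with hμ
  rw [mul_assoc]
  refine le_trans ?_ (mul_le_mul_right (h.sum_sqDifference_patch_le hd hC hg q) _)
  rw [Finset.mul_sum]
  refine Finset.sum_le_sum fun T hT => ?_
  have hT := h.isMesh.mem_elements.1 hT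
  set S := essSupport (ψ T) with hS
  have hSfin : μ S ≠ ∞ := by
    refine ne_top_of_le_ne_top ?_ ((measure_mono (hpatch T hT)).trans (h.measure_patch_le q hT))
    exact ENNReal.mul_ne_top (by finiteness) (h.measure_ne_top hT)
  have hTS : μ T ≤ μ S := measure_mono (hsupp T hT)
  have hT0 := h.measure_ne_zero hT
  have hS0 : μ S ≠ 0 := fun h0 => hT0 (le_antisymm (h0 ▸ hTS) bot_le)
  have hinner : ∫ x, inner ℂ (v x) (ψ T x) ∂μ = 0 := horth T hT
  have hmain := measure_mul_lintegral_sq_le_sqDifference μ (Lp.stronglyMeasurable v).measurable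
    (Lp.memLp v) (Lp.memLp (ψ T)) hS0 hSfin (ae_eq_zero_of_notMem_essSupport (ψ T)) hinner hρ0
    (happrox T hT) T
  set a := ENNReal.ofReal (1 - ρ) with ha
  set b := ENNReal.ofReal (1 + ρ) with hb
  set I := ∫⁻ x in T, ‖v x‖ₑ ^ 2 ∂μ with hI
  have ha0 : a ^ 2 ≠ 0 := pow_ne_zero _ (by simpa [ha] using hρ1)
  have hafin : a ^ 2 ≠ ∞ := ENNReal.pow_ne_top ENNReal.ofReal_ne_top
  have hle : a ^ 2 * (μ T * I) ≤ b ^ 2 * sqDifference μ v T (patch 𝒯 q T) := by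
    calc a ^ 2 * (μ T * I) ≤ a ^ 2 * μ S * I := by rw [← mul_assoc]; gcongr
      _ ≤ b ^ 2 * sqDifference μ v T S := hmain
      _ ≤ _ := by
        gcongr
        exact lintegral_mono fun x => lintegral_mono_set (hpatch T hT)
  have hle' : μ T * I ≤ (b / a) ^ 2 * sqDifference μ v T (patch 𝒯 q T) := by
    calc μ T * I = (a ^ 2)⁻¹ * (a ^ 2 * (μ T * I)) := by
          rw [← mul_assoc, ENNReal.inv_mul_cancel ha0 hafin, one_mul]
      _ ≤ (a ^ 2)⁻¹ * (b ^ 2 * sqDifference μ v T (patch 𝒯 q T)) := by gcongr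
      _ = _ := by rw [div_eq_mul_inv, mul_pow, ENNReal.inv_pow]; ring
  calc (ENNReal.ofReal (Metric.diam T))⁻¹ * I
      = (ENNReal.ofReal (Metric.diam T))⁻¹ * ((μ T)⁻¹ * (μ T * I)) := by
        rw [← mul_assoc (μ T)⁻¹, ENNReal.inv_mul_cancel hT0 (h.measure_ne_top hT), one_mul]
    _ ≤ (ENNReal.ofReal (Metric.diam T))⁻¹ *
          ((μ T)⁻¹ * ((b / a) ^ 2 * sqDifference μ v T (patch 𝒯 q T))) := by gcongr
    _ = _ := by
        rw [ENNReal.mul_inv (.inl (h.ofReal_diam_ne_zero hT)) (.inl ENNReal.ofReal_ne_top)]; ring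

/-! ### The mesh-width weighted gradient -/

lemma IsMesh.elementSize_le_meshWidth (h : IsMesh Γ 𝒯) {T : Set (Eucl d)} (hT : T ∈ 𝒯)
    {x : Eucl d} (hx : x ∈ T) : elementSize Γ T ≤ meshWidth Γ 𝒯 x := by
  refine le_csSup (Set.Finite.bddAbove ?_) ⟨T, hT, hx, rfl⟩
  refine (h.finite.image (elementSize Γ)).subset ?_
  rintro _ ⟨T', hT', -, rfl⟩
  exact ⟨T', hT', rfl⟩

/-- The mesh-width function is at least `h_T` on `T`, and `diam(T) ≤ C h_T`. -/
lemma IsMesh.sum_localGradient_le (h : IsMesh Γ 𝒯) {C : ℝ} (hC : 0 < C)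
    (hshape : ShapeRegular Γ 𝒯 C) (g : L2Field Γ) :
    ∑ T ∈ h.elements, localGradient Γ g T ≤ ENNReal.ofReal C *
      eLpNorm (fun x => √(meshWidth Γ 𝒯 x) • g x) 2 (surfaceMeasure Γ) ^ 2 := by
  have hpt : ∀ T ∈ h.elements, localGradient Γ g T ≤ ENNReal.ofReal C *
      ∫⁻ x in T, ‖√(meshWidth Γ 𝒯 x) • g x‖ₑ ^ 2 ∂(surfaceMeasure Γ) := by
    intro T hT
    have hT := h.mem_elements.1 hT
    rw [localGradient, ← lintegral_const_mul' _ _ ENNReal.ofReal_ne_top,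
      ← lintegral_const_mul' _ _ ENNReal.ofReal_ne_top]
    refine setLIntegral_mono' (h.measurableSet hT) fun x hx => ?_
    have hw := h.elementSize_le_meshWidth hT hx
    have hw0 : 0 ≤ meshWidth Γ 𝒯 x := (hshape.elementSize_pos hC hT).le.trans hw
    rw [enorm_smul, mul_pow, ← mul_assoc, Real.enorm_eq_ofReal (Real.sqrt_nonneg _),
      ← ENNReal.ofReal_pow (Real.sqrt_nonneg _), Real.sq_sqrt hw0, ← ENNReal.ofReal_mul hC.le]
    gcongr
    exact (hshape.diam_le hC hT).trans (by gcongr)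
  calc _ ≤ _ := Finset.sum_le_sum hpt
    _ ≤ _ := by
      rw [← Finset.mul_sum, h.sum_setLIntegral_eq (Finset.Subset.refl _), eLpNorm_two_sq]
      exact mul_le_mul_right (setLIntegral_le_lintegral _ _) _

/-! ### The global estimate -/

lemma IsRegularMesh.lintegral_sq_le {N L K : ℝ≥0} (h : IsRegularMesh Γ 𝒯 N L K)
    (hΓ : Bornology.IsBounded Γ) (v : Eucl d → ℂ) :
    ∫⁻ x, ‖v x‖ₑ ^ 2 ∂(surfaceMeasure Γ) ≤ ENNReal.ofReal (Metric.diam Γ) *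
      ∑ T ∈ h.isMesh.elements,
        (ENNReal.ofReal (Metric.diam T))⁻¹ * ∫⁻ x in T, ‖v x‖ₑ ^ 2 ∂(surfaceMeasure Γ) := by
  have hrestrict : ∫⁻ x, ‖v x‖ₑ ^ 2 ∂(surfaceMeasure Γ) =
      ∫⁻ x in Γ, ‖v x‖ₑ ^ 2 ∂(surfaceMeasure Γ) := by
    rw [surfaceMeasure, Measure.restrict_restrict_of_subset subset_rfl]
  rw [hrestrict, Finset.mul_sum]
  have hcover : ∫⁻ x in Γ, ‖v x‖ₑ ^ 2 ∂(surfaceMeasure Γ) ≤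
      ∫⁻ x in ⋃ T ∈ h.isMesh.elements, T, ‖v x‖ₑ ^ 2 ∂(surfaceMeasure Γ) :=
    lintegral_mono_set h.isMesh.biUnion_elements.ge
  refine (hcover.trans (setLIntegral_biUnion_finset_le _ _ _ _)).trans
    (Finset.sum_le_sum fun T hT => ?_)
  have hT := h.isMesh.mem_elements.1 hT
  rw [← mul_assoc]
  refine le_mul_of_one_le_left zero_le ?_
  rw [← ENNReal.mul_inv_cancel (h.ofReal_diam_ne_zero hT) ENNReal.ofReal_ne_top]
  gcongr
  exact Metric.diam_mono (h.isMesh.subset hT) hΓ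

/-- The estimate for a single component, with an explicit constant. -/
lemma IsRegularMesh.norm_sq_le (hd : 2 ≤ d) {N L K : ℝ≥0} (h : IsRegularMesh Γ 𝒯 N L K)
    (hΓ : Bornology.IsBounded Γ) {A : ℝ≥0}
    (hA : ∀ (x : Eucl d) (r : ℝ), 0 ≤ r →
      surfaceMeasure Γ (Metric.closedBall x r) ≤ A * ENNReal.ofReal r ^ (d - 1))
    {Ccent Cshape : ℝ} (hCcent : 0 < Ccent) (hcent : CenteredInPatches Γ 𝒯 Ccent)
    (hCshape : 0 < Cshape) (hshape : ShapeRegular Γ 𝒯 Cshape)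
    {C : ℝ≥0} (hC : LocalSeminormEstimate Γ 𝒯 C) {v : L2 Γ}
    {g : L2Field Γ} (hg : HasSurfaceGradient Γ v g) {q : ℕ} {ρ : ℝ} (hρ0 : 0 ≤ ρ) (hρ1 : ρ < 1)
    {ψ : Set (Eucl d) → L2 Γ} (hsupp : ∀ T ∈ 𝒯, T ⊆ essSupport (ψ T))
    (hpatch : ∀ T ∈ 𝒯, essSupport (ψ T) ⊆ patch 𝒯 q T)
    (happrox : ∀ T ∈ 𝒯,
      eLpNorm (fun x => 1 - ψ T x) 2 ((surfaceMeasure Γ).restrict (essSupport (ψ T))) ≤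
        ENNReal.ofReal ρ * (surfaceMeasure Γ (essSupport (ψ T))) ^ (1 / 2 : ℝ))
    (horth : ∀ T ∈ 𝒯, inner ℂ v (ψ T) = 0) :
    eLpNorm v 2 (surfaceMeasure Γ) ^ 2 + slobodeckijSeminorm Γ (1 / 2) Γ v ^ 2 ≤
      ((ENNReal.ofReal (Metric.diam Γ) + 4 * (A * 2 ^ d * ENNReal.ofReal Ccent)) *
          ((ENNReal.ofReal (1 + ρ) / ENNReal.ofReal (1 - ρ)) ^ 2 * poincareConst d N L K C q) +
        2 * C ^ 2 * L ^ 2 * N ^ 2) * ENNReal.ofReal Cshape *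
      eLpNorm (fun x => √(meshWidth Γ 𝒯 x) • g x) 2 (surfaceMeasure Γ) ^ 2 := by
  have : IsLocallyFiniteMeasure (surfaceMeasure Γ) :=
    ⟨fun x => ⟨Metric.closedBall x 1, Metric.closedBall_mem_nhds x one_pos,
      (hA x 1 zero_le_one).trans_lt (by finiteness)⟩⟩
  set E := ∑ T ∈ h.isMesh.elements, localGradient Γ g T with hE
  set P := ∑ T ∈ h.isMesh.elements,
    (ENNReal.ofReal (Metric.diam T))⁻¹ * ∫⁻ x in T, ‖v x‖ₑ ^ 2 ∂(surfaceMeasure Γ) with hP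
  have hPE := h.sum_inv_diam_mul_le hd hC hg hρ0 hρ1 hsupp hpatch happrox horth
  have hnear : ∑ T ∈ h.isMesh.elements, ∑ T' ∈ h.isMesh.neighbors T,
      slobodeckijEnergy (surfaceMeasure Γ) v T T' ≤ 2 * C ^ 2 * L ^ 2 * N ^ 2 * E := by
    calc _ ≤ ∑ T ∈ h.isMesh.elements, N * (2 * C ^ 2 * L ^ 2 *
          ∑ T' ∈ h.isMesh.neighbors T, localGradient Γ g T') := by
          refine Finset.sum_le_sum fun T hT => ?_
          have hT := h.isMesh.mem_elements.1 hT
          exact h.sum_neighbors_le hT _ fun T' hT' => h.slobodeckijEnergy_neighbor_le hC hg hT hT'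
      _ = N * (2 * C ^ 2 * L ^ 2) * ∑ T ∈ h.isMesh.elements,
          ∑ T' ∈ h.isMesh.neighbors T, localGradient Γ g T' := by
          simp_rw [← Finset.mul_sum, mul_assoc]
      _ ≤ N * (2 * C ^ 2 * L ^ 2) * (N * E) := by
          gcongr; exact h.sum_sum_neighbors_le _
      _ = _ := by ring
  rw [eLpNorm_two_sq, slobodeckijSeminorm_sq]
  calc _ ≤ ENNReal.ofReal (Metric.diam Γ) * P + (2 * C ^ 2 * L ^ 2 * N ^ 2 * E +
        4 * (A * 2 ^ d * ENNReal.ofReal Ccent) * P) := by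
        gcongr
        · exact h.lintegral_sq_le hΓ v
        · exact (h.slobodeckijEnergy_le hd hCcent hcent hA
            (Lp.stronglyMeasurable v).measurable).trans (by gcongr)
    _ = (ENNReal.ofReal (Metric.diam Γ) + 4 * (A * 2 ^ d * ENNReal.ofReal Ccent)) * P +
        2 * C ^ 2 * L ^ 2 * N ^ 2 * E := by ring
    _ ≤ (ENNReal.ofReal (Metric.diam Γ) + 4 * (A * 2 ^ d * ENNReal.ofReal Ccent)) *
          ((ENNReal.ofReal (1 + ρ) / ENNReal.ofReal (1 - ρ)) ^ 2 *
            poincareConst d N L K C q * E) + 2 * C ^ 2 * L ^ 2 * N ^ 2 * E := by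
        gcongr
    _ = ((ENNReal.ofReal (Metric.diam Γ) + 4 * (A * 2 ^ d * ENNReal.ofReal Ccent)) *
          ((ENNReal.ofReal (1 + ρ) / ENNReal.ofReal (1 - ρ)) ^ 2 * poincareConst d N L K C q) +
        2 * C ^ 2 * L ^ 2 * N ^ 2) * E := by ring
    _ ≤ _ := by
        rw [mul_assoc _ (ENNReal.ofReal Cshape)]
        gcongr
        exact h.isMesh.sum_localGradient_le hCshape hshape g

end BEM

end

theorem corollary4p3 (d : ℕ) (hd : 2 ≤ d) (Ω : Set (BEM.Eucl d))
    (hΩ : BEM.IsBoundedLipschitzDomain Ω)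
    (Cpatch Clocuni Cshape Ccent Csemi : ℝ) (hpatch : 0 < Cpatch) (hlocuni : 0 < Clocuni)
    (hshape : 0 < Cshape) (hcent : 0 < Ccent) (hsemi : 0 < Csemi)
    (qsupp : ℕ) (ρ : ℝ) (hρ0 : 0 < ρ) (hρ1 : ρ < 1) :
    ∃ C : ℝ, 0 < C ∧
      ∀ (D : ℕ) (𝒯 : Set (Set (BEM.Eucl d))) (X : Submodule ℂ (Fin D → BEM.L2 (frontier Ω)))
        (Ψ : Set (BEM.Eucl d) → Fin D → (Fin D → BEM.L2 (frontier Ω))),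
        BEM.IsMesh (frontier Ω) 𝒯 →
        BEM.BoundedPatch 𝒯 Cpatch →
        BEM.LocallyQuasiUniform 𝒯 Clocuni →
        BEM.ShapeRegular (frontier Ω) 𝒯 Cshape →
        BEM.CenteredInPatches (frontier Ω) 𝒯 Ccent →
        BEM.LocalSeminormEstimate (frontier Ω) 𝒯 Csemi →
        FiniteDimensional ℂ X →
        BEM.ApproximatesUnity (frontier Ω) 𝒯 X qsupp ρ Ψ →
        ∀ (v : Fin D → BEM.L2 (frontier Ω)) (g : Fin D → BEM.L2Field (frontier Ω)),
          (∀ j, BEM.HasSurfaceGradient (frontier Ω) (v j) (g j)) →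
          (∀ T ∈ 𝒯, ∀ j, ∑ i, inner ℂ (v i) (Ψ T j i) = 0) →
          BEM.slobodeckijNorm (frontier Ω) (1 / 2) v ≤
            ENNReal.ofReal C * BEM.weightedGradientNorm (frontier Ω) 𝒯 g := by
  obtain ⟨A, hA⟩ := hΩ.exists_surfaceMeasure_closedBall_le
  set N := Cpatch.toNNReal
  set L := Clocuni.toNNReal
  set K := Cshape.toNNReal ^ (d - 1)
  set S := Csemi.toNNReal
  set B : ℝ≥0∞ := ((ENNReal.ofReal (Metric.diam (frontier Ω)) +
        4 * (A * 2 ^ d * ENNReal.ofReal Ccent)) *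
      ((ENNReal.ofReal (1 + ρ) / ENNReal.ofReal (1 - ρ)) ^ 2 *
        BEM.poincareConst d N L K S qsupp) +
    2 * S ^ 2 * L ^ 2 * N ^ 2) * ENNReal.ofReal Cshape with hB
  have hBfin : B ≠ ∞ := by
    have h1 : ENNReal.ofReal (1 + ρ) / ENNReal.ofReal (1 - ρ) ≠ ∞ :=
      ENNReal.div_ne_top ENNReal.ofReal_ne_top (by simpa using hρ1)
    rw [hB]; finiteness
  have hBsqrt : B ^ (1 / 2 : ℝ) ≠ ∞ := ENNReal.rpow_ne_top_of_nonneg (by norm_num) hBfin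
  -- the summand `1` makes the constant positive even if `B = 0`
  refine ⟨(B ^ (1 / 2 : ℝ)).toReal + 1, by positivity, ?_⟩
  intro D 𝒯 X Ψ hmesh h1 h2 h3 h4 h5 _ hΨ v g hg horth
  have hreg := hmesh.isRegularMesh hd hlocuni hshape h1 h2 h3
  have h5' : BEM.LocalSeminormEstimate (frontier Ω) 𝒯 (S : ℝ) := by
    rwa [Real.coe_toNNReal _ hsemi.le]
  have hsupp : ∀ T ∈ 𝒯, ∀ j, BEM.vecSupport (Ψ T j) = BEM.essSupport (Ψ T j j) :=
    fun T hT j => BEM.vecSupport_eq (hΨ.other_components T hT j)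
  have hcomp : ∀ j, eLpNorm (v j) 2 (BEM.surfaceMeasure (frontier Ω)) ^ 2 +
      BEM.slobodeckijSeminorm (frontier Ω) (1 / 2) (frontier Ω) (v j) ^ 2 ≤
      B * eLpNorm (fun x => √(BEM.meshWidth (frontier Ω) 𝒯 x) • g j x) 2
        (BEM.surfaceMeasure (frontier Ω)) ^ 2 := by
    intro j
    refine hreg.norm_sq_le hd (hΩ.isBounded.closure.subset frontier_subset_closure) hA hcent h4
      hshape h3 h5' (hg j) hρ0.le hρ1 (ψ := fun T => Ψ T j j) (fun T hT => ?_) (fun T hT => ?_)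
      (fun T hT => ?_) (fun T hT => ?_)
    · exact hsupp T hT j ▸ hΨ.subset_support T hT j
    · exact hsupp T hT j ▸ hΨ.support_subset T hT j
    · have := hΨ.approx T hT j
      rwa [hsupp T hT j] at this
    · have hsum : ∑ i, inner ℂ (v i) (Ψ T j i) = inner ℂ (v j) (Ψ T j j) := by
        refine Finset.sum_eq_single j (fun i _ hi => ?_)
          fun hj => absurd (Finset.mem_univ j) hj
        rw [hΨ.other_components T hT j i hi, inner_zero_right]
      rw [← hsum, horth T hT j]
  calc BEM.slobodeckijNorm (frontier Ω) (1 / 2) v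
      ≤ (∑ j, B * eLpNorm (fun x => √(BEM.meshWidth (frontier Ω) 𝒯 x) • g j x) 2
          (BEM.surfaceMeasure (frontier Ω)) ^ 2) ^ (1 / 2 : ℝ) := by
        unfold BEM.slobodeckijNorm
        gcongr with j
        exact hcomp j
    _ = B ^ (1 / 2 : ℝ) * BEM.weightedGradientNorm (frontier Ω) 𝒯 g := by
        rw [← Finset.mul_sum, ENNReal.mul_rpow_of_nonneg _ _ (by norm_num)]
        rfl
    _ ≤ _ := by
        gcongr
        rw [← ENNReal.ofReal_toReal hBsqrt, ENNReal.toReal_ofReal ENNReal.toReal_nonneg]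
        exact ENNReal.ofReal_le_ofReal (by linarith)
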